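/- Let $f:\mathbb R\to[-1,0)$ be Lipschitz and $2\pi$-periodic with $f<-\delta$ for some $\delta>0$, and let $Z=\{y\in\mathbb R^2: y_2>f(y_1)\}$ and $Z_\#=\{y\in Z: 0<y_1<2\pi\}$. Let $D^{1,2}$ be the set of $v\in L^1_{\rm loc}(Z)$ that are $2\pi$-periodic in $y_1$ and have weak gradient in $L^2(Z_\#)^2$. Let $\beta,\gamma\in D^{1,2}$ be the ($y_1$-periodic) weak solutions of the cell problems $$-\Delta\beta=0\ \text{in } Z,\quad \beta=-y_2\ \text{on } \{y_2=f(y_1)\};\qquad -\Delta\gamma=0\ \text{in } Z,\quad \gamma=-y_2^2\ \text{on } \{y_2=f(y_1)\},$$ that is, they have these traces and $\int_{Z_\#}\nabla\beta\cdot\nabla v=\int_{Z_\#}\nabla\gamma\cdot\nabla v=0$ for all $v\in D^{1,2}$ with zero trace on $\{y_2=f(y_1)\}$. Put $$\bar\beta=\frac1{2\pi}\int_0^{2\pi}\beta(y_1,0)\,dy_1,\qquad \bar\gamma=\frac1{2\pi}\int_0^{2\pi}\gamma(y_1,0)\,dy_1 .$$ Let $\varepsilon>0$, let $N\ge 1$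 be an integer, $L=2\pi\varepsilon N$, $C\in\mathbb R$, $\Omega^0=(0,L)\times(0,1)$, $\Gamma^0=\{x_2=0\}$, $\Gamma^1=\{x_2=1\}$, and let $H^{1,1}_\#(\Omega^0)$ be the space of $v\in H^1(\Omega^0)$ that are $L$-periodic in $x_1$, vanish on $\Gamma^1$, and have a trace on $\Gamma^0$ belonging to (periodic) $H^1(\Gamma^0)$. Then the problem $$-\Delta u=C\ \text{in }\Omega^0,\qquad u=\varepsilon\bar\beta\,\partial_2u+\frac{\varepsilon^2}{2}\bar\gamma\,\partial_2^2u\ \text{on }\Gamma^0,\qquad u=0\ \text{on }\Gamma^1,\qquad u\ \text{is } x_1\text{-periodic}$$ has a unique solution $u$ in $H^{1,1}_\#(\Omega^0)$. Here the equation holds in the sense of distributions for the periodic extension of $u$ to $\mathbb R\times(0,1)$, and the condition on $\Gamma^0$ in the sense of periodic distributions: for every smooth $L$-periodic $\varphi$ the function $m_\varphi(x_2)=\int_0^Lu(x_1,x_2)\varphi(x_1)\,dx_1$ coincides a.e. on $(0,1)$ with a function that is $C^2$ up to $x_2=0$, and $m_\varphi(0)=\varepsilon\bar\beta\, m_\varphi'(0)+\frac{\varepsilon^2}{2}\bar\gamma\,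 m_\varphi''(0)$. The same $u$ is also the unique solution in $H^{1,1}_\#(\Omega^0)$ of the variational formulation $$\frac1{\varepsilon\bar\beta}(u,v)_{\Gamma^0}+(\nabla u,\nabla v)_{\Omega^0}-\frac{\varepsilon\bar\gamma}{2\bar\beta}(\partial_1u,\partial_1v)_{\Gamma^0}=(C,v)_{\Omega^0}-\frac{\varepsilon\bar\gamma}{2\bar\beta}(C,v)_{\Gamma^0}\qquad\text{for all } v\in H^{1,1}_\#(\Omega^0),$$ where $(\cdot,\cdot)$ denotes $L^2$ inner products. -/

import Mathlib

open MeasureTheory Set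
open scoped ContDiff

namespace WallLaw

/-! ### Weak derivatives and traces in the plane -/

/-- `φ` is a test function on `Ω`: smooth, with compact support contained in `Ω`. -/
def IsTest (Ω : Set (ℝ × ℝ)) (φ : ℝ × ℝ → ℝ) : Prop :=
  ContDiff ℝ ∞ φ ∧ HasCompactSupport φ ∧ tsupport φ ⊆ Ω

/-- First partial derivative of a (differentiable) function on the plane. -/
noncomputable def pd1 (φ : ℝ × ℝ → ℝ) (x : ℝ × ℝ) : ℝ := fderiv ℝ φ x (1, 0)

/-- Second partial derivative of a (differentiable) function on the plane. -/
noncomputable def pd2 (φ : ℝ × ℝ → ℝ) (x : ℝ × ℝ) : ℝ := fderiv ℝ φ x (0, 1)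

/-- `d1` and `d2` are the weak partial derivatives of `v` on the open set `Ω`
(all three being locally integrable on `Ω`). -/
structure HasWeakGradient (Ω : Set (ℝ × ℝ)) (v d1 d2 : ℝ × ℝ → ℝ) : Prop where
  locInt : LocallyIntegrableOn v Ω
  locInt_d1 : LocallyIntegrableOn d1 Ω
  locInt_d2 : LocallyIntegrableOn d2 Ω
  weak_d1 : ∀ φ, IsTest Ω φ → ∫ x in Ω, v x * pd1 φ x = -∫ x in Ω, d1 x * φ x
  weak_d2 : ∀ φ, IsTest Ω φ → ∫ x in Ω, v x * pd2 φ x = -∫ x in Ω, d2 x * φ x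

/-- `T`-periodicity in the first variable. -/
def PeriodicX1 (T : ℝ) (v : ℝ × ℝ → ℝ) : Prop :=
  ∀ x₁ x₂, v (x₁ + T, x₂) = v (x₁, x₂)

/-- The region above the graph of `h`. -/
def above (h : ℝ → ℝ) : Set (ℝ × ℝ) := {y | h y.1 < y.2}

/-- `g` is the trace of `v` on the graph of `h`, `v` being a function on the region above this
graph with weak second derivative `d2`. The trace is expressed by the Gauss-Green formula in the
second variable (on the graph, `n₂ ds = - dy₁` for the outer normal `n`), which determines `g`
almost everywhere. -/
structure HasGraphTrace (h : ℝ → ℝ) (v d2 : ℝ × ℝ → ℝ) (g : ℝ → ℝ) : Prop where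
  locInt : LocallyIntegrable g
  int_v : ∀ K, IsCompact K → IntegrableOn v (above h ∩ K)
  int_d2 : ∀ K, IsCompact K → IntegrableOn d2 (above h ∩ K)
  green : ∀ φ, IsTest univ φ →
    ∫ y in above h, (v y * pd2 φ y + d2 y * φ y) = -∫ t : ℝ, g t * φ (t, h t)

/-! ### The cell problems -/

/-- One period of the cell domain: `0 < y₁ < 2π`, `f y₁ < y₂`, unbounded in the `y₂` direction. -/
def cell (f : ℝ → ℝ) : Set (ℝ × ℝ) := {y | y.1 ∈ Ioo 0 (2 * Real.pi) ∧ f y.1 < y.2}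

/-- The space `D^{1,2}` on the cell domain: locally integrable functions, `2π`-periodic in `y₁`,
with weak gradient square integrable over one period. An element is a representative `toFun`
together with (periodic representatives of) its weak partial derivatives. -/
structure D12 (f : ℝ → ℝ) where
  toFun : ℝ × ℝ → ℝ
  d1 : ℝ × ℝ → ℝ
  d2 : ℝ × ℝ → ℝ
  periodic : PeriodicX1 (2 * Real.pi) toFun
  periodic_d1 : PeriodicX1 (2 * Real.pi) d1
  periodic_d2 : PeriodicX1 (2 * Real.pi) d2
  weak : HasWeakGradient (above f) toFun d1 d2
  memLp_d1 : MemLp d1 2 (volume.restrict (cell f))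
  memLp_d2 : MemLp d2 2 (volume.restrict (cell f))

/-- `b ∈ D^{1,2}` is the weak solution of the cell problem `-Δ b = 0` above the graph of `f`,
`b = g` on the graph, `b` being `2π`-periodic in `y₁`. -/
def IsCellSolution (f g : ℝ → ℝ) (b : D12 f) : Prop :=
  HasGraphTrace f b.toFun b.d2 g ∧
  ∀ v : D12 f, HasGraphTrace f v.toFun v.d2 (fun _ => 0) →
    ∫ y in cell f, (b.d1 y * v.d1 y + b.d2 y * v.d2 y) = 0

/-- `m` is the mean over one period of the trace of `b` on the interface `y₂ = 0`. -/
def HasInterfaceMean {f : ℝ → ℝ} (b : D12 f) (m : ℝ) : Prop :=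
  ∃ η : ℝ → ℝ, HasGraphTrace (fun _ => 0) b.toFun b.d2 η ∧
    m = 1 / (2 * Real.pi) * ∫ t in (0 : ℝ)..(2 * Real.pi), η t

/-! ### The macroscopic domain `Ω⁰ = (0, L) × (0, 1)` and the space `H^{1,1}_#(Ω⁰)` -/

/-- The domain `Ω⁰`. -/
def Omega0 (L : ℝ) : Set (ℝ × ℝ) := Ioo 0 L ×ˢ Ioo 0 1

/-- The horizontal strip covered by the periodic repetitions of `Ω⁰`. -/
def strip : Set (ℝ × ℝ) := univ ×ˢ Ioo 0 1

/-- `g0` and `g1` are the traces of `v` (with weak second derivative `d2` on the strip) on the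
lines `x₂ = 0` and `x₂ = 1`, expressed by the Gauss-Green formula in the second variable. -/
structure HasStripTraces (v d2 : ℝ × ℝ → ℝ) (g0 g1 : ℝ → ℝ) : Prop where
  locInt0 : LocallyIntegrable g0
  locInt1 : LocallyIntegrable g1
  green : ∀ φ, IsTest univ φ →
    ∫ x in strip, (v x * pd2 φ x + d2 x * φ x) =
      (∫ t : ℝ, g1 t * φ (t, 1)) - ∫ t : ℝ, g0 t * φ (t, 0)

/-- The space `H^{1,1}_#(Ω⁰)`: functions in `H¹(Ω⁰)`, `L`-periodic in `x₁`, vanishing on `Γ¹`, and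
whose trace on `Γ⁰` is in `H¹(Γ⁰)`. An element is a representative `toFun` together with (periodic
representatives of) its weak partial derivatives `d1`, `d2`, its trace `tr` on `Γ⁰` and the weak
derivative `dtr` of this trace; all of them are determined by `toFun` almost everywhere. -/
structure H11 (L : ℝ) where
  toFun : ℝ × ℝ → ℝ
  d1 : ℝ × ℝ → ℝ
  d2 : ℝ × ℝ → ℝ
  tr : ℝ → ℝ
  dtr : ℝ → ℝ
  periodic : PeriodicX1 L toFun
  periodic_d1 : PeriodicX1 L d1
  periodic_d2 : PeriodicX1 L d2
  periodic_tr : Function.Periodic tr L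
  periodic_dtr : Function.Periodic dtr L
  weak : HasWeakGradient strip toFun d1 d2
  memLp : MemLp toFun 2 (volume.restrict (Omega0 L))
  memLp_d1 : MemLp d1 2 (volume.restrict (Omega0 L))
  memLp_d2 : MemLp d2 2 (volume.restrict (Omega0 L))
  traces : HasStripTraces toFun d2 tr (fun _ => 0)
  memLp_tr : MemLp tr 2 (volume.restrict (Ioo 0 L))
  memLp_dtr : MemLp dtr 2 (volume.restrict (Ioo 0 L))
  weak_tr : ∀ ψ : ℝ → ℝ, ContDiff ℝ ∞ ψ → HasCompactSupport ψ →
    ∫ t : ℝ, tr t * deriv ψ t = -∫ t : ℝ, dtr t * ψ t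

/-- Equality in `H^{1,1}_#(Ω⁰)`: almost everywhere equality on `Ω⁰`. -/
def H11.Same {L : ℝ} (u w : H11 L) : Prop :=
  u.toFun =ᵐ[volume.restrict (Omega0 L)] w.toFun

/-- `-Δ u = C` in the sense of distributions. Test functions live on the strip, so the equation
also holds across the lateral sides, as is meant by periodicity of the solution. -/
def SolvesPoisson {L : ℝ} (C : ℝ) (u : H11 L) : Prop :=
  ∀ φ, IsTest strip φ →
    ∫ x in strip, (u.d1 x * pd1 φ x + u.d2 x * pd2 φ x) = C * ∫ x in strip, φ x

/-- The boundary condition `u = ε b ∂₂u + (ε²/2) c ∂₂²u` on `Γ⁰`, in the sense of periodic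
distributions on `Γ⁰`: against every smooth `L`-periodic `φ`, the pairing
`x₂ ↦ ∫₀ᴸ u(x₁, x₂) φ(x₁) dx₁` is (a.e. equal on `(0,1)` to a function `m` that is) `C²` up to
`x₂ = 0`, so that `m 0`, `m' 0`, `m'' 0` are the pairings of the traces of `u`, `∂₂u`, `∂₂²u` on
`Γ⁰` with `φ`, and these satisfy the condition. -/
def SolvesWentzell {L : ℝ} (ε b c : ℝ) (u : H11 L) : Prop :=
  ∀ φ : ℝ → ℝ, ContDiff ℝ ∞ φ → Function.Periodic φ L →
    ∃ m : ℝ → ℝ, ContDiff ℝ 2 m ∧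
      (∀ᵐ t ∂(volume.restrict (Ioo (0 : ℝ) 1)), ∫ s in (0 : ℝ)..L, u.toFun (s, t) * φ s = m t) ∧
      m 0 = ε * b * deriv m 0 + ε ^ 2 / 2 * c * iteratedDeriv 2 m 0

/-- `u` solves the second-order averaged wall law (distributional sense). The conditions `u = 0` on
`Γ¹` and `x₁`-periodicity are part of the space `H11 L`. -/
def IsSolution {L : ℝ} (C ε b c : ℝ) (u : H11 L) : Prop :=
  SolvesPoisson C u ∧ SolvesWentzell ε b c u

/-- The symmetric bilinear form of the wall law. -/
noncomputable def formA {L : ℝ} (ε b c : ℝ) (u v : H11 L) : ℝ :=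
  1 / (ε * b) * (∫ t in Ioo 0 L, u.tr t * v.tr t)
    + (∫ x in Omega0 L, (u.d1 x * v.d1 x + u.d2 x * v.d2 x))
    - ε * (c / (2 * b)) * ∫ t in Ioo 0 L, u.dtr t * v.dtr t

/-- The linear form of the wall law. -/
noncomputable def formL {L : ℝ} (C ε b c : ℝ) (v : H11 L) : ℝ :=
  (∫ x in Omega0 L, C * v.toFun x) - ε * (c / (2 * b)) * ∫ t in Ioo 0 L, C * v.tr t

/-- `u` solves the second-order averaged wall law in the variational sense. -/
def IsVariationalSolution {L : ℝ} (C ε b c : ℝ) (u : H11 L) : Prop :=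
  ∀ v : H11 L, formA ε b c u v = formL C ε b c v

end WallLaw

namespace WallLaw

/-! ### Partial derivatives of smooth functions -/

/-! Everything rests on two signs: `βbar` is positive and `γbar` is nonpositive. Both come from a
maximum principle for the cell problems. If the boundary data are at most `c`, truncate the solution
`b` to `F(b)`, where `F` vanishes up to `c`, is positive beyond, and `0 ≤ F' ≤ 1`. Then `F(b)` has
zero trace and is an admissible test function, so `∫ F'(b)|∇b|² = 0`. Hence `∂₂F(b) = 0`, and since
`F(b)` starts from `0` on almost every vertical line, `F(b) = 0` and `b ≤ c`. The bound passes to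
the mean on `y₂ = 0`. Applied to `-β`, with data `f < -δ`, and to `γ`, with data `-f² ≤ 0`, this
gives `βbar ≥ δ` and `γbar ≤ 0`. The tools are `HasGraphTrace.ae_eq_primitive` (absolute continuity
on vertical lines, deduced from the Green formula that defines traces) and the chain rules
`HasGraphTrace.comp` and `HasWeakGradient.comp`.

Existence needs no functional analysis: all data are constant in `x₁`, so a quadratic polynomial in
`x₂` solves both formulations (`exists_profile`).

Variational uniqueness holds because the signs make the three terms of the form nonnegative on the
diagonal. The form therefore controls `∂₂` of a difference of solutions, and an element of `H11`,
vanishing on `Γ¹`, is determined by its `∂₂`.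

Distributional uniqueness cannot test with the solution itself, so it goes mode by mode. The pairing
of a solution with a trigonometric function of frequency `√k` is a `C²` function of `x₂`. After
subtraction of the pairing of the polynomial it satisfies `n'' = k n`, `n(1) = 0` and the boundary
condition at `0`; an energy identity with the same signs forces `n = 0` (`eq_zero_of_mode`,
`IsSolution.pairing_eq`). Parseval's identity on almost every horizontal line concludes. -/

theorem hasDerivAt_pd1 {φ : ℝ × ℝ → ℝ} (hφ : Differentiable ℝ φ) (t s : ℝ) :
    HasDerivAt (fun r => φ (r, s)) (pd1 φ (t, s)) t := by
  have h : HasDerivAt (fun r : ℝ => (r, s)) ((1 : ℝ), (0 : ℝ)) t :=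
    (hasDerivAt_id t).prodMk (hasDerivAt_const t s)
  exact (hφ (t, s)).hasFDerivAt.comp_hasDerivAt t h

theorem hasDerivAt_pd2 {φ : ℝ × ℝ → ℝ} (hφ : Differentiable ℝ φ) (t s : ℝ) :
    HasDerivAt (fun r => φ (t, r)) (pd2 φ (t, s)) s := by
  have h : HasDerivAt (fun r : ℝ => (t, r)) ((0 : ℝ), (1 : ℝ)) s :=
    (hasDerivAt_const s t).prodMk (hasDerivAt_id s)
  exact (hφ (t, s)).hasFDerivAt.comp_hasDerivAt s h

theorem continuous_pd1 {φ : ℝ × ℝ → ℝ} (hφ : ContDiff ℝ ∞ φ) : Continuous (pd1 φ) :=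
  (hφ.continuous_fderiv (by simp)).clm_apply continuous_const

theorem continuous_pd2 {φ : ℝ × ℝ → ℝ} (hφ : ContDiff ℝ ∞ φ) : Continuous (pd2 φ) :=
  (hφ.continuous_fderiv (by simp)).clm_apply continuous_const

theorem hasCompactSupport_pd1 {φ : ℝ × ℝ → ℝ} (hφ : HasCompactSupport φ) :
    HasCompactSupport (pd1 φ) := hφ.fderiv_apply ℝ _

theorem hasCompactSupport_pd2 {φ : ℝ × ℝ → ℝ} (hφ : HasCompactSupport φ) :
    HasCompactSupport (pd2 φ) := hφ.fderiv_apply ℝ _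

theorem tsupport_pd2_subset (φ : ℝ × ℝ → ℝ) : tsupport (pd2 φ) ⊆ tsupport φ :=
  tsupport_fderiv_apply_subset ℝ _

theorem isOpen_above {h : ℝ → ℝ} (hh : Continuous h) : IsOpen (above h) :=
  isOpen_lt (hh.comp continuous_fst) continuous_snd

theorem IsTest.exists_bound {Ω : Set (ℝ × ℝ)} {φ : ℝ × ℝ → ℝ} (hφ : IsTest Ω φ) :
    ∃ R, 0 < R ∧ ∀ t s, φ (t, s) ≠ 0 → |t| < R ∧ |s| < R := by
  obtain ⟨R, hR⟩ := hφ.2.1.isCompact.isBounded.exists_norm_le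
  refine ⟨|R| + 1, by positivity, fun t s h => ?_⟩
  have := hR (t, s) (subset_tsupport _ h)
  rw [Prod.norm_def, max_le_iff] at this
  simp only [Real.norm_eq_abs] at this
  have h2 := le_abs_self R
  constructor <;> linarith [this.1, this.2]

theorem integrable_mul_of_integrableOn_compact {U : Set (ℝ × ℝ)} {v ρ : ℝ × ℝ → ℝ}
    (hv : ∀ K, IsCompact K → IntegrableOn v (U ∩ K))
    (hρ : Continuous ρ) (hc : HasCompactSupport ρ) :
    IntegrableOn (fun x => v x * ρ x) U := by
  obtain ⟨M, hM⟩ := hc.exists_bound_of_continuous hρ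
  have h1 : IntegrableOn (fun x => v x * ρ x) (U ∩ tsupport ρ) := by
    exact Integrable.mul_bdd (hv _ hc.isCompact) hρ.aestronglyMeasurable
      (Filter.Eventually.of_forall hM)
  refine (integrableOn_iff_integrable_of_support_subset (s := tsupport ρ) ?_).1 ?_
  · intro x hx
    exact subset_tsupport _ (right_ne_zero_of_mul hx)
  · rw [IntegrableOn, Measure.restrict_restrict (isClosed_tsupport _).measurableSet, inter_comm]
    exact h1

/-! ### Vertical primitives of test functions -/

/-- Integrating over `r > s` is convolution in `s` with the indicator of the negative half-line, so
joint smoothness follows from smoothness of convolutions with a parameter. -/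
theorem exists_vertical_primitive {ψ : ℝ × ℝ → ℝ} (hψ : IsTest univ ψ) :
    ∃ Φ : ℝ × ℝ → ℝ, ContDiff ℝ ∞ Φ ∧ (∀ t s, Φ (t, s) = -∫ r in Ioi s, ψ (t, r)) ∧
      ∀ y, pd2 Φ y = ψ y := by
  obtain ⟨R, hR, hsupp⟩ := hψ.exists_bound
  set H : ℝ → ℝ := (Iio 0).indicator 1
  have hH : LocallyIntegrable H :=
    (locallyIntegrable_const (1 : ℝ)).indicator measurableSet_Iio
  have hcd := contDiffOn_convolution_right_with_param (μ := (volume : Measure ℝ))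
    (f := H) (n := ⊤) (ContinuousLinearMap.mul ℝ ℝ) (g := fun t s => ψ (t, s)) (s := univ)
    (k := Icc (-R) R) isOpen_univ isCompact_Icc
    (by
      intro t s _ hs
      by_contra h
      exact hs (abs_le.1 (hsupp t s h).2.le)) hH hψ.1.contDiffOn
  rw [univ_prod_univ, contDiffOn_univ] at hcd
  have hint : ∀ t, Integrable (fun r => ψ (t, r)) := fun t =>
    (hψ.1.continuous.comp (by fun_prop)).integrable_of_hasCompactSupport
      (HasCompactSupport.of_support_subset_isCompact (isCompact_Icc (a := -R) (b := R))
        fun s hs => abs_le.1 (hsupp t s hs).2.le)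
  have hformula : ∀ t s, -(convolution H (fun s => ψ (t, s)) (ContinuousLinearMap.mul ℝ ℝ) volume) s
      = -∫ r in Ioi s, ψ (t, r) := by
    intro t s
    rw [convolution]
    congr 1
    rw [← integral_indicator measurableSet_Ioi,
      ← integral_sub_left_eq_self ((Ioi s).indicator fun r => ψ (t, r)) volume s]
    congr 1
    ext r
    simp only [H, indicator, mem_Iio, mem_Ioi, Pi.one_apply]
    by_cases hr : r < 0
    · simp [hr]
    · have : ¬ s < s - r := by linarith
      simp [hr, this]
  refine ⟨fun q => -(convolution H (fun s => ψ (q.1, s)) (ContinuousLinearMap.mul ℝ ℝ) volume) q.2,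
    hcd.neg, hformula, ?_⟩
  rintro ⟨t, s⟩
  have h1 := hasDerivAt_pd2 (hcd.neg.differentiable (by simp)) t s
  refine h1.unique ?_
  have h2 : (fun r => -(convolution H (fun s => ψ (t, s)) (ContinuousLinearMap.mul ℝ ℝ) volume) r)
      = fun r => (∫ x in s..r, ψ (t, x)) - ∫ x in Ioi s, ψ (t, x) := by
    ext r
    have := intervalIntegral.integral_interval_add_Ioi' ((hint t).intervalIntegrable (a := s))
      ((hint t).integrableOn (s := Ioi r))
    rw [hformula, ← this]
    ring
  rw [h2]
  have hc : Continuous fun r => ψ (t, r) := hψ.1.continuous.comp (by fun_prop)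
  exact (intervalIntegral.integral_hasDerivAt_right (hc.intervalIntegrable _ _)
    hc.stronglyMeasurable.stronglyMeasurableAtFilter hc.continuousAt).sub_const _

/-! ### Absolute continuity on vertical lines -/

/-- Exchanging the two heights over the same abscissa is the order change of Fubini on `r < s`.
Phrased as a measure-preserving map, it carries integrability over along with the value of the
integral. -/
theorem exists_swap_right :
    ∃ e : (ℝ × ℝ) × ℝ ≃ᵐ (ℝ × ℝ) × ℝ, (∀ t r s, e ((t, r), s) = ((t, s), r)) ∧
      MeasurePreserving e := by
  refine ⟨(MeasurableEquiv.prodAssoc.trans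
    ((MeasurableEquiv.refl ℝ).prodCongr MeasurableEquiv.prodComm)).trans
      MeasurableEquiv.prodAssoc.symm, fun t r s => rfl, ?_⟩
  have h1 := volume_preserving_prodAssoc (α₁ := ℝ) (β₁ := ℝ) (γ₁ := ℝ)
  have h2 : MeasurePreserving ((MeasurableEquiv.refl ℝ).prodCongr
      (MeasurableEquiv.prodComm : ℝ × ℝ ≃ᵐ ℝ × ℝ)) :=
    (MeasurePreserving.id volume).prod Measure.measurePreserving_swap
  exact (h1.symm _).comp (h2.comp h1)

theorem integrable_primitive_kernel {D ρ : ℝ × ℝ → ℝ} {m R M : ℝ} (hD : LocallyIntegrable D)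
    (hm : ∀ t s, s ≤ m → D (t, s) = 0) (hρ : AEStronglyMeasurable ρ)
    (hM : ∀ y, ‖ρ y‖ ≤ M) (hsupp : ∀ t s, ρ (t, s) ≠ 0 → |t| ≤ R ∧ |s| ≤ R) :
    Integrable (fun z : (ℝ × ℝ) × ℝ => ρ z.1 * (Iio z.1.2).indicator (fun r => D (z.1.1, r)) z.2) ∧
    Integrable (fun z : (ℝ × ℝ) × ℝ => D z.1 * (Ioi z.1.2).indicator (fun s => ρ (z.1.1, s)) z.2) ∧
    (∫ z : (ℝ × ℝ) × ℝ, ρ z.1 * (Iio z.1.2).indicator (fun r => D (z.1.1, r)) z.2) =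
      ∫ z : (ℝ × ℝ) × ℝ, D z.1 * (Ioi z.1.2).indicator (fun s => ρ (z.1.1, s)) z.2 := by
  obtain ⟨e, he, hmp⟩ := exists_swap_right
  set G := fun z : (ℝ × ℝ) × ℝ => ρ z.1 * (Iio z.1.2).indicator (fun r => D (z.1.1, r)) z.2
  set H := fun z : (ℝ × ℝ) × ℝ => D z.1 * (Ioi z.1.2).indicator (fun s => ρ (z.1.1, s)) z.2
  have hGH : G ∘ e = H := by
    ext ⟨⟨t, r⟩, s⟩
    simp only [G, H, Function.comp, he, indicator, mem_Iio, mem_Ioi]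
    split_ifs <;> ring
  have hHint : Integrable H := by
    -- Where the kernel is nonzero, `r > m` because `D` vanishes below `m`, and `r < s ≤ R` by the
    -- support of `ρ`. The kernel is thus dominated by `|D|` on the compact set `B` times a constant
    -- on `[-R, R]`.
    set B : Set (ℝ × ℝ) := Icc (-R) R ×ˢ Icc m R
    have hB : IsCompact B := isCompact_Icc.prod isCompact_Icc
    have h1 : Integrable (B.indicator D) :=
      (hD.integrableOn_isCompact hB).integrable_indicator hB.measurableSet
    have h2 : Integrable ((Icc (-R) R).indicator fun _ : ℝ => M) :=
      (integrable_indicator_iff measurableSet_Icc).2 (by simp [IntegrableOn])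
    refine (h1.mul_prod h2).mono ?_ (Filter.Eventually.of_forall ?_)
    · have hr : AEStronglyMeasurable (fun z : (ℝ × ℝ) × ℝ => ρ (e z).1) :=
        (hρ.comp_fst (ν := (volume : Measure ℝ))).comp_measurePreserving hmp
      have hs : MeasurableSet {z : (ℝ × ℝ) × ℝ | z.1.2 < z.2} :=
        measurableSet_lt (by fun_prop) (by fun_prop)
      refine (hD.aestronglyMeasurable.comp_fst (ν := (volume : Measure ℝ))).mul
        ((hr.indicator hs).congr (Filter.Eventually.of_forall ?_))
      rintro ⟨⟨t, r⟩, s⟩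
      simp [indicator, he]
    · rintro ⟨⟨t, r⟩, s⟩
      simp only [H, indicator, mem_Ioi]
      by_cases hrs : r < s
      swap
      · simp [hrs]
      by_cases hρ0 : ρ (t, s) = 0
      · simp [hρ0]
      by_cases hrm : r ≤ m
      · simp [hm t r hrm]
      obtain ⟨ht, hs⟩ := hsupp t s hρ0
      have hs' := abs_le.1 hs
      have hM0 : 0 ≤ M := (norm_nonneg _).trans (hM (t, s))
      have hb : (t, r) ∈ B := ⟨abs_le.1 ht, by constructor <;> linarith⟩
      rw [if_pos hrs, if_pos hb, if_pos (show s ∈ Icc (-R) R from hs'), norm_mul, norm_mul]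
      gcongr
      exact (hM _).trans (le_abs_self M)
  have hGint : Integrable G := (hmp.integrable_comp_emb e.measurableEmbedding).1 (by rwa [hGH])
  refine ⟨hGint, hHint, ?_⟩
  rw [← hGH]
  exact (hmp.integral_comp e.measurableEmbedding G).symm

theorem locallyIntegrable_primitive {D : ℝ × ℝ → ℝ} {m : ℝ} (hD : LocallyIntegrable D)
    (hm : ∀ t s, s ≤ m → D (t, s) = 0) :
    LocallyIntegrable (fun y : ℝ × ℝ => ∫ r in Iio y.2, D (y.1, r)) := by
  rw [locallyIntegrable_iff]
  intro k hk
  obtain ⟨R, hR⟩ := hk.isBounded.exists_norm_le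
  have h := (integrable_primitive_kernel (ρ := k.indicator 1) (m := m) (R := R) (M := 1) hD hm
    (aestronglyMeasurable_one.indicator hk.measurableSet)
    (fun y => by by_cases hy : y ∈ k <;> simp [hy]) (fun t s h => by
      have := hR _ (mem_of_indicator_ne_zero h)
      simpa [Prod.norm_def] using this)).1
  rw [← integrable_indicator_iff hk.measurableSet]
  refine h.integral_prod_left.congr (Filter.Eventually.of_forall fun y => ?_)
  simp only [integral_const_mul, integral_indicator measurableSet_Iio]
  by_cases hy : y ∈ k <;> simp [hy]

theorem integral_primitive_mul {D ψ : ℝ × ℝ → ℝ} {m : ℝ} (hD : LocallyIntegrable D)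
    (hm : ∀ t s, s ≤ m → D (t, s) = 0) (hψ : IsTest univ ψ) :
    ∫ y : ℝ × ℝ, ψ y * ∫ r in Iio y.2, D (y.1, r) = ∫ y, D y * ∫ s in Ioi y.2, ψ (y.1, s) := by
  obtain ⟨R, hR, hsupp⟩ := hψ.exists_bound
  obtain ⟨M, hM⟩ := hψ.2.1.exists_bound_of_continuous hψ.1.continuous
  obtain ⟨h1, h2, h3⟩ := integrable_primitive_kernel (R := R) hD hm
    hψ.1.continuous.aestronglyMeasurable hM
    (fun t s h => ⟨(hsupp t s h).1.le, (hsupp t s h).2.le⟩)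
  have e1 := integral_prod _ h1
  have e2 := integral_prod _ h2
  simp only [integral_const_mul, integral_indicator measurableSet_Iio,
    integral_indicator measurableSet_Ioi] at e1 e2
  exact e1.symm.trans (h3.trans e2)

theorem locallyIntegrable_comp_fst {g : ℝ → ℝ} (hg : LocallyIntegrable g) :
    LocallyIntegrable (fun y : ℝ × ℝ => g y.1) := by
  rw [locallyIntegrable_iff]
  intro k hk
  have hk' : k ⊆ (Prod.fst '' k) ×ˢ (Prod.snd '' k) := fun y hy =>
    ⟨mem_image_of_mem _ hy, mem_image_of_mem _ hy⟩
  refine IntegrableOn.mono_set ?_ hk'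
  rw [IntegrableOn, Measure.volume_eq_prod, ← Measure.prod_restrict]
  have h2 : IntegrableOn (fun _ : ℝ => (1 : ℝ)) (Prod.snd '' k) :=
    continuousOn_const.integrableOn_compact (hk.image continuous_snd)
  simpa using Integrable.mul_prod (hg.integrableOn_isCompact (hk.image continuous_fst)) h2

theorem locallyIntegrable_indicator_above {h : ℝ → ℝ} (hh : Continuous h) {v : ℝ × ℝ → ℝ}
    (hv : ∀ K, IsCompact K → IntegrableOn v (above h ∩ K)) :
    LocallyIntegrable ((above h).indicator v) := by
  rw [locallyIntegrable_iff]
  intro k hk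
  rw [IntegrableOn, integrable_indicator_iff (isOpen_above hh).measurableSet, IntegrableOn,
    Measure.restrict_restrict (isOpen_above hh).measurableSet]
  exact hv k hk

/-- A function with a trace on the graph of `h` is, on almost every vertical line, the primitive of
its weak derivative that starts from the trace. -/
theorem HasGraphTrace.ae_eq_primitive {h : ℝ → ℝ} {v d g} (H : HasGraphTrace h v d g)
    (hh : Continuous h) {m : ℝ} (hm : ∀ t, m ≤ h t) :
    ∀ᵐ y : ℝ × ℝ, y ∈ above h → v y = g y.1 + ∫ r in h y.1..y.2, d (y.1, r) := by
  have hU := isOpen_above hh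
  set D := (above h).indicator d with hDdef
  have hD : LocallyIntegrable D := locallyIntegrable_indicator_above hh H.int_d2
  have hD0 : ∀ t s, s ≤ m → D (t, s) = 0 := fun t s hs =>
    indicator_of_notMem (s := above h) (fun hy => by
      have : h t < s := hy
      linarith [hm t]) _
  have hV : LocallyIntegrable ((above h).indicator v) := locallyIntegrable_indicator_above hh H.int_v
  have hG := locallyIntegrable_comp_fst H.locInt
  have hP := locallyIntegrable_primitive hD hD0
  set P := fun y : ℝ × ℝ => ∫ r in Iio y.2, D (y.1, r) with hPdef
  have key : ∀ᵐ y : ℝ × ℝ, y ∈ above h → (above h).indicator v y - g y.1 - P y = 0 := by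
    refine hU.ae_eq_zero_of_integral_contDiff_smul_eq_zero
      (((hV.sub hG).sub hP).locallyIntegrableOn _) ?_
    intro ψ hψ hψc hψU
    have hψt : IsTest univ ψ := ⟨hψ, hψc, subset_univ _⟩
    have i1 : Integrable (fun y => ψ y * (above h).indicator v y) :=
      hV.integrable_smul_left_of_hasCompactSupport hψ.continuous hψc
    have i2 : Integrable (fun y => ψ y * g y.1) :=
      hG.integrable_smul_left_of_hasCompactSupport hψ.continuous hψc
    have i3 : Integrable (fun y => ψ y * P y) :=
      hP.integrable_smul_left_of_hasCompactSupport hψ.continuous hψc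
    have i12 : Integrable (fun y => ψ y * (above h).indicator v y - ψ y * g y.1) := i1.sub i2
    simp only [smul_eq_mul, mul_sub]
    rw [integral_sub i12 i3, integral_sub i1 i2]
    -- The Green formula is to be used with a function whose `∂₂` is `ψ`: it then pairs `v` with `ψ`
    -- itself, and Fubini turns the term in `d` into minus the pairing of `P` with `ψ`.
    obtain ⟨Φ, hΦ, hΦe, hΦ2⟩ := exists_vertical_primitive hψt
    obtain ⟨R, hR, hsupp⟩ := hψt.exists_bound
    -- `Φ` need not vanish far below the support of `ψ`. The cutoff is `1` for `s ≥ m`, hence on and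
    -- above the graph, and `0` for `s ≤ m - 1`; it restores compact support without changing
    -- anything the Green formula sees.
    set κ : ℝ → ℝ := fun s => Real.smoothTransition (s - m + 1) with hκdef
    have hκ : ContDiff ℝ ∞ κ := Real.smoothTransition.contDiff.comp (by fun_prop)
    have hκ1 : ∀ s, m ≤ s → κ s = 1 := fun s hs => Real.smoothTransition.one_of_one_le (by linarith)
    set φ : ℝ × ℝ → ℝ := fun y => Φ y * κ y.2 with hφdef
    have hφ : IsTest univ φ := by
      refine ⟨hΦ.mul (hκ.comp contDiff_snd), ?_, subset_univ _⟩
      refine HasCompactSupport.of_support_subset_isCompact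
        ((isCompact_Icc (a := -R) (b := R)).prod (isCompact_Icc (a := m - 1) (b := R))) ?_
      rintro ⟨t, s⟩ hy
      have hy1 : Φ (t, s) ≠ 0 := left_ne_zero_of_mul hy
      have hy2 : κ s ≠ 0 := right_ne_zero_of_mul hy
      have hs : m - 1 ≤ s := by
        by_contra hs
        exact hy2 (Real.smoothTransition.zero_of_nonpos (by linarith))
      rw [hΦe] at hy1
      have : ∃ r, s < r ∧ ψ (t, r) ≠ 0 := by
        by_contra hcon
        push Not at hcon
        apply hy1
        rw [neg_eq_zero]
        exact setIntegral_eq_zero_of_forall_eq_zero fun r hr => hcon r hr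
      obtain ⟨r, hsr, hr⟩ := this
      obtain ⟨h1, h2⟩ := hsupp t r hr
      exact ⟨abs_le.1 h1.le, hs, by linarith [(abs_lt.1 h2).2]⟩
    have hφ_eq : ∀ t s, h t ≤ s → φ (t, s) = Φ (t, s) := fun t s hs => by
      simp [hφdef, hκ1 s ((hm t).trans hs)]
    have hφ_pd2 : ∀ y ∈ above h, pd2 φ y = ψ y := by
      rintro ⟨t, s⟩ (hy : h t < s)
      rw [← hΦ2]
      refine (hasDerivAt_pd2 (hφ.1.differentiable (by simp)) t s).unique ?_
      refine (hasDerivAt_pd2 (hΦ.differentiable (by simp)) t s).congr_of_eventuallyEq ?_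
      filter_upwards [Ioi_mem_nhds hy] with r hr using hφ_eq t r (le_of_lt hr)
    have green := H.green φ hφ
    have j1 : IntegrableOn (fun y => v y * ψ y) (above h) :=
      integrable_mul_of_integrableOn_compact H.int_v hψ.continuous hψc
    have j2 : IntegrableOn (fun y => d y * φ y) (above h) :=
      integrable_mul_of_integrableOn_compact H.int_d2 hφ.1.continuous hφ.2.1
    have e1 : ∫ y in above h, (v y * pd2 φ y + d y * φ y) =
        (∫ y in above h, v y * ψ y) + ∫ y in above h, d y * φ y := by
      rw [← integral_add j1 j2]
      exact setIntegral_congr_fun hU.measurableSet fun y hy => by simp only [hφ_pd2 y hy]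
    have e2 : ∫ y in above h, v y * ψ y = ∫ y, ψ y * (above h).indicator v y := by
      rw [← integral_indicator hU.measurableSet]
      congr 1; ext y
      by_cases hy : y ∈ above h <;> simp [hy, mul_comm]
    have e3 : ∫ y in above h, d y * φ y = -∫ y, ψ y * P y := by
      rw [integral_primitive_mul hD hD0 hψt, ← integral_neg, ← integral_indicator hU.measurableSet]
      congr 1; ext ⟨t, s⟩
      by_cases hy : (t, s) ∈ above h
      · simp [hy, hDdef, hφ_eq t s (le_of_lt hy), hΦe]
      · simp [hy, hDdef]
    have e4 : ∫ t, g t * φ (t, h t) = -∫ y, ψ y * g y.1 := by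
      rw [Measure.volume_eq_prod, integral_prod _ (by rwa [← Measure.volume_eq_prod]),
        ← integral_neg]
      congr 1; ext t
      simp only
      rw [hφ_eq t _ le_rfl, hΦe, integral_mul_const, ← integral_indicator measurableSet_Ioi]
      -- As `ψ` is supported above the graph, `Φ` on the graph is minus the integral of `ψ` over the
      -- whole vertical line.
      have : (Ioi (h t)).indicator (fun r => ψ (t, r)) = fun r => ψ (t, r) := by
        ext r
        refine indicator_apply_eq_self.2 fun hr => ?_
        by_contra hne
        exact hr (hψU (subset_tsupport _ hne))
      rw [this]; ring
    rw [e1, e2, e3, e4] at green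
    linarith
  filter_upwards [key] with y hy hyU
  have := hy hyU
  rw [indicator_of_mem hyU] at this
  have hPy : P y = ∫ r in h y.1..y.2, d (y.1, r) := by
    rw [intervalIntegral.integral_of_le (le_of_lt hyU), integral_Ioc_eq_integral_Ioo, hPdef]
    simp only
    rw [← integral_indicator measurableSet_Iio, ← integral_indicator measurableSet_Ioo]
    congr 1; ext r
    by_cases h1 : r < y.2 <;> by_cases h2 : h y.1 < r <;> simp [indicator, hDdef, above, h1, h2]
  rw [← hPy]; linarith

/-! ### The chain rule for functions with a trace -/

theorem _root_.AbsolutelyContinuousOnInterval.lipschitz_comp {F p : ℝ → ℝ} {a b : ℝ}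
    (hF : LipschitzWith 1 F) (hp : AbsolutelyContinuousOnInterval p a b) :
    AbsolutelyContinuousOnInterval (fun s => F (p s)) a b := by
  rw [absolutelyContinuousOnInterval_iff] at hp ⊢
  intro ε hε
  obtain ⟨δ, hδ, h⟩ := hp ε hε
  refine ⟨δ, hδ, fun E hE1 hE2 => lt_of_le_of_lt (Finset.sum_le_sum fun i _ => ?_) (h E hE1 hE2)⟩
  simpa using hF.dist_le_mul (p (E.2 i).1) (p (E.2 i).2)

theorem lipschitzWith_one_of_hasDerivAt {F F' : ℝ → ℝ} (hF : ∀ x, HasDerivAt F (F' x) x)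
    (hb : ∀ x, |F' x| ≤ 1) : LipschitzWith 1 F :=
  lipschitzWith_of_nnnorm_deriv_le (fun x => (hF x).differentiableAt) fun x => by
    rw [(hF x).deriv, ← NNReal.coe_le_coe]
    simpa using hb x

/-- A Lipschitz function of an absolutely continuous function is absolutely continuous, so
integration by parts applies to `F(p)φ`, and the chain rule holds at almost every point, where `p' =
d`. -/
theorem integral_comp_primitive_mul {F F' : ℝ → ℝ} (hF : ∀ x, HasDerivAt F (F' x) x)
    (hb : ∀ x, |F' x| ≤ 1) {d φ : ℝ → ℝ} {a b c : ℝ} (hd : IntervalIntegrable d volume a b)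
    (hφ : ContDiff ℝ ∞ φ) :
    ∫ s in a..b, (F (c + ∫ r in a..s, d r) * deriv φ s + F' (c + ∫ r in a..s, d r) * d s * φ s) =
      F (c + ∫ r in a..b, d r) * φ b - F c * φ a := by
  have hp0 := hd.absolutelyContinuousOnInterval_intervalIntegral (c := a) (by simp)
  have hp : AbsolutelyContinuousOnInterval (fun s => c + ∫ r in a..s, d r) a b :=
    (LipschitzOnWith.absolutelyContinuousOnInterval (K := 0)
      (LipschitzWith.const c).lipschitzOnWith).add hp0
  have hFp := hp.lipschitz_comp (lipschitzWith_one_of_hasDerivAt hF hb)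
  have hφa : AbsolutelyContinuousOnInterval φ a b :=
    (hφ.of_le (by simp)).contDiffOn.absolutelyContinuousOnInterval
  have := hFp.integral_deriv_mul_eq_sub hφa
  simp only [intervalIntegral.integral_same, add_zero] at this
  rw [← this]
  refine intervalIntegral.integral_congr_ae ?_
  filter_upwards [hd.ae_hasDerivAt_integral] with s hs hs'
  have h1 := hs (uIoc_subset_uIcc hs') a (by simp)
  have h2 := ((hF (c + ∫ r in a..s, d r)).comp s (h1.const_add c)).deriv
  simp only [Function.comp_def] at h2
  rw [h2]; ring

theorem ae_integrableOn_line {D : ℝ × ℝ → ℝ} (hD : LocallyIntegrable D) :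
    ∀ᵐ t : ℝ, ∀ a b : ℝ, IntegrableOn (fun s => D (t, s)) (Icc a b) := by
  have h : ∀ n : ℕ, ∀ᵐ t : ℝ, t ∈ Icc (-n : ℝ) n →
      IntegrableOn (fun s => D (t, s)) (Icc (-n : ℝ) n) := by
    intro n
    have := hD.integrableOn_isCompact
      ((isCompact_Icc (a := (-n : ℝ)) (b := n)).prod (isCompact_Icc (a := (-n : ℝ)) (b := n)))
    rw [IntegrableOn, Measure.volume_eq_prod, ← Measure.prod_restrict] at this
    exact (ae_restrict_iff' measurableSet_Icc).1 this.prod_right_ae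
  filter_upwards [ae_all_iff.2 h] with t ht a b
  obtain ⟨n, hn⟩ := exists_nat_ge (max |t| (max |a| |b|))
  simp only [max_le_iff] at hn
  refine (ht n (abs_le.1 hn.1)).mono_set (Icc_subset_Icc ?_ ?_)
  · exact (abs_le.1 hn.2.1).1
  · exact (abs_le.1 hn.2.2).2

theorem norm_le_of_lipschitz {F : ℝ → ℝ} (hF : LipschitzWith 1 F) (x : ℝ) :
    ‖F x‖ ≤ ‖‖F 0‖ + ‖x‖‖ := by
  have h := hF.dist_le_mul x 0
  simp only [NNReal.coe_one, one_mul, dist_eq_norm, sub_zero] at h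
  have := norm_sub_norm_le (F x) (F 0)
  rw [Real.norm_of_nonneg (add_nonneg (norm_nonneg _) (norm_nonneg x))]
  linarith

theorem IntegrableOn.lipschitz_comp {α : Type*} [MeasurableSpace α] {μ : Measure α} {s : Set α}
    {F : ℝ → ℝ} {v : α → ℝ} (hF : LipschitzWith 1 F) (hv : IntegrableOn v s μ) (hs : μ s ≠ ⊤) :
    IntegrableOn (fun x => F (v x)) s μ := by
  have hc : IntegrableOn (fun _ => ‖F 0‖) s μ := integrableOn_const hs
  exact Integrable.mono (hc.add hv.norm) (hF.continuous.comp_aestronglyMeasurable hv.1)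
    (Filter.Eventually.of_forall fun x => norm_le_of_lipschitz hF (v x))

theorem IntegrableOn.bounded_comp_mul {α : Type*} [MeasurableSpace α] {μ : Measure α} {s : Set α}
    {F : ℝ → ℝ} {v d : α → ℝ} (hF : Continuous F) (hb : ∀ x, |F x| ≤ 1)
    (hv : AEStronglyMeasurable v (μ.restrict s)) (hd : IntegrableOn d s μ) :
    IntegrableOn (fun x => F (v x) * d x) s μ :=
  Integrable.bdd_mul hd (hF.comp_aestronglyMeasurable hv)
    (Filter.Eventually.of_forall fun x => hb (v x))

/-- On almost every vertical line `v` is the primitive of `d` starting from `g`, which reduces the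
Green formula for `F(v)` to the one-dimensional integration by parts, integrated over the lines. -/
theorem HasGraphTrace.comp {h : ℝ → ℝ} {v d g} (H : HasGraphTrace h v d g)
    (hh : Continuous h) {m : ℝ} (hm : ∀ t, m ≤ h t) {F F' : ℝ → ℝ}
    (hF : ∀ x, HasDerivAt F (F' x) x) (hF' : Continuous F') (hb : ∀ x, |F' x| ≤ 1) :
    HasGraphTrace h (fun y => F (v y)) (fun y => F' (v y) * d y) (fun t => F (g t)) := by
  have hL := lipschitzWith_one_of_hasDerivAt hF hb
  have hU := (isOpen_above hh).measurableSet
  have iv : ∀ K, IsCompact K → IntegrableOn (fun y => F (v y)) (above h ∩ K) := fun K hK =>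
    IntegrableOn.lipschitz_comp hL (H.int_v K hK)
      ((measure_mono inter_subset_right).trans_lt hK.measure_lt_top).ne
  have id : ∀ K, IsCompact K → IntegrableOn (fun y => F' (v y) * d y) (above h ∩ K) :=
    fun K hK => IntegrableOn.bounded_comp_mul hF' hb (H.int_v K hK).1 (H.int_d2 K hK)
  refine ⟨?_, iv, id, ?_⟩
  · rw [locallyIntegrable_iff]
    intro k hk
    exact IntegrableOn.lipschitz_comp hL (H.locInt.integrableOn_isCompact hk) hk.measure_lt_top.ne
  · intro φ hφ
    have j : IntegrableOn (fun y => F (v y) * pd2 φ y + F' (v y) * d y * φ y) (above h) :=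
      (integrable_mul_of_integrableOn_compact iv (continuous_pd2 hφ.1)
        (hasCompactSupport_pd2 hφ.2.1)).add
        (integrable_mul_of_integrableOn_compact id hφ.1.continuous hφ.2.1)
    rw [← integral_indicator hU, Measure.volume_eq_prod, integral_prod _ (by
      rw [← Measure.volume_eq_prod]; exact (integrable_indicator_iff hU).2 j), ← integral_neg]
    refine integral_congr_ae ?_
    have hrep := H.ae_eq_primitive hh hm
    rw [Measure.volume_eq_prod] at hrep
    obtain ⟨R, hR, hsupp⟩ := hφ.exists_bound
    filter_upwards [Measure.ae_ae_of_ae_prod hrep,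
      ae_integrableOn_line (locallyIntegrable_indicator_above hh H.int_d2)] with t ht htd
    -- Any height above the graph at which `φ` already vanishes would do; the maximum ensures both.
    set b := max (h t) R with hbdef
    have hab : h t ≤ b := le_max_left _ _
    have hdt : IntervalIntegrable (fun s => d (t, s)) volume (h t) b := by
      rw [intervalIntegrable_iff_integrableOn_Ioc_of_le hab]
      refine ((htd (h t) b).mono_set Ioc_subset_Icc_self).congr_fun (fun s hs => ?_)
        measurableSet_Ioc
      exact indicator_of_mem (show (t, s) ∈ above h from hs.1) _
    have hφt : ContDiff ℝ ∞ (fun s => φ (t, s)) := hφ.1.comp (by fun_prop)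
    have hφb : φ (t, b) = 0 := by
      by_contra hne
      have := (abs_lt.1 (hsupp t b hne).2).2
      exact absurd (le_max_right (h t) R) (by linarith)
    have key := integral_comp_primitive_mul hF hb (c := g t) hdt hφt
    rw [hφb, mul_zero, zero_sub] at key
    rw [← key, intervalIntegral.integral_of_le hab, ← integral_indicator measurableSet_Ioc]
    refine integral_congr_ae ?_
    filter_upwards [ht] with s hs
    by_cases h1 : h t < s
    · have hmem : (t, s) ∈ above h := h1
      rw [indicator_of_mem hmem, (hasDerivAt_pd2 (hφ.1.differentiable (by simp)) t s).deriv.symm,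
        hs hmem]
      by_cases h2 : s ≤ b
      · rw [indicator_of_mem (show s ∈ Ioc (h t) b from ⟨h1, h2⟩)]
      · rw [indicator_of_notMem (fun hh => h2 hh.2)]
        have hev : (fun r => φ (t, r)) =ᶠ[nhds s] fun _ => 0 := by
          filter_upwards [Ioi_mem_nhds (not_le.1 h2)] with r hr
          by_contra hne
          have := (abs_lt.1 (hsupp t r hne).2).2
          have hr' : b < r := hr
          exact absurd (le_max_right (h t) R) (by linarith)
        rw [hev.deriv_eq, hev.eq_of_nhds]
        simp
    · rw [indicator_of_notMem (show (t, s) ∉ above h from h1),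
        indicator_of_notMem (fun hh => h1 hh.1)]

/-! ### The chain rule for weak gradients -/

theorem exists_cutoff {Ω K : Set (ℝ × ℝ)} (hΩ : IsOpen Ω) (hK : IsCompact K) (hKΩ : K ⊆ Ω) :
    ∃ χ : ℝ × ℝ → ℝ, IsTest Ω χ ∧ ∀ y ∈ K, ∀ᶠ z in nhds y, χ z = 1 := by
  obtain ⟨L, hL, hKL, hLΩ⟩ := exists_compact_between hK hΩ hKΩ
  obtain ⟨χ, h1, h0, -⟩ := exists_contMDiffMap_one_nhds_of_subset_interior (n := ⊤)
    (modelWithCornersSelf ℝ (ℝ × ℝ)) hK.isClosed hKL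
  have hsupp : tsupport χ ⊆ L := closure_minimal (fun x hx => by
    by_contra hxL
    exact hx (h0 x hxL)) hL.isClosed
  exact ⟨χ, ⟨χ.contMDiff.contDiff, hL.of_isClosed_subset (isClosed_tsupport _) hsupp,
    hsupp.trans hLΩ⟩, fun y hy => eventually_nhdsSet_iff_forall.1 h1 y hy⟩

theorem pd2_mul {χ φ : ℝ × ℝ → ℝ} (hχ : Differentiable ℝ χ) (hφ : Differentiable ℝ φ) (y : ℝ × ℝ) :
    pd2 (fun z => χ z * φ z) y = χ y * pd2 φ y + pd2 χ y * φ y := by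
  simp only [pd2]
  rw [fderiv_fun_mul (hχ y) (hφ y)]
  simp [mul_comm]

theorem IsTest.mul {Ω : Set (ℝ × ℝ)} {χ φ : ℝ × ℝ → ℝ} (hχ : IsTest Ω χ) (hφ : ContDiff ℝ ∞ φ) :
    IsTest Ω (fun y => χ y * φ y) :=
  ⟨hχ.1.mul hφ, hχ.2.1.mul_right, (tsupport_mul_subset_left).trans hχ.2.2⟩

theorem integrableOn_mul_of_tsupport_subset {Ω : Set (ℝ × ℝ)} {v ρ : ℝ × ℝ → ℝ}
    (hv : LocallyIntegrableOn v Ω) (hρ : Continuous ρ) (hc : HasCompactSupport ρ)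
    (hs : tsupport ρ ⊆ Ω) : Integrable (fun x => v x * ρ x) := by
  have h1 : IntegrableOn (fun x => v x * ρ x) (tsupport ρ) := by
    obtain ⟨M, hM⟩ := hc.exists_bound_of_continuous hρ
    exact Integrable.mul_bdd (hv.integrableOn_compact_subset hs hc.isCompact)
      hρ.aestronglyMeasurable (Filter.Eventually.of_forall hM)
  refine (integrableOn_iff_integrable_of_support_subset ?_).1 h1
  intro x hx
  exact subset_tsupport _ (right_ne_zero_of_mul hx)

/-- Localization reduces this to the chain rule with traces: after multiplication by a cutoff equal
to `1` near the support of `φ`, the function extends by zero to a half-plane on whose boundary line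
its trace is zero. -/
theorem weak_pd2_comp {Ω : Set (ℝ × ℝ)} (hΩ : IsOpen Ω) {v d : ℝ × ℝ → ℝ}
    (hv : LocallyIntegrableOn v Ω) (hd : LocallyIntegrableOn d Ω)
    (hw : ∀ φ, IsTest Ω φ → ∫ x in Ω, v x * pd2 φ x = -∫ x in Ω, d x * φ x)
    {F F' : ℝ → ℝ} (hF : ∀ x, HasDerivAt F (F' x) x) (hF' : Continuous F') (hb : ∀ x, |F' x| ≤ 1)
    {φ : ℝ × ℝ → ℝ} (hφ : IsTest Ω φ) :
    ∫ x in Ω, F (v x) * pd2 φ x = -∫ x in Ω, F' (v x) * d x * φ x := by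
  obtain ⟨χ, hχ, hχ1⟩ := exists_cutoff hΩ hφ.2.1 hφ.2.2
  obtain ⟨R, hR, hsupp⟩ := hχ.exists_bound
  have hχd := hχ.1.differentiable (by simp)
  set V := fun y => v y * χ y with hVdef
  set D := fun y => d y * χ y + v y * pd2 χ y with hDdef
  have hV : Integrable V := integrableOn_mul_of_tsupport_subset hv hχ.1.continuous hχ.2.1 hχ.2.2
  have hD : Integrable D :=
    (integrableOn_mul_of_tsupport_subset hd hχ.1.continuous hχ.2.1 hχ.2.2).add
    (integrableOn_mul_of_tsupport_subset hv (continuous_pd2 hχ.1) (hasCompactSupport_pd2 hχ.2.1)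
      ((tsupport_pd2_subset χ).trans hχ.2.2))
  have hpos : ∀ y, y ∈ tsupport χ → -(R + 1) < y.2 := by
    have hcl : IsClosed {y : ℝ × ℝ | -R ≤ y.2} := isClosed_le continuous_const continuous_snd
    intro y hy
    have := closure_minimal (s := Function.support χ) (fun z hz => by
      have := (abs_lt.1 (hsupp z.1 z.2 hz).2).1
      exact this.le) hcl hy
    have : -R ≤ y.2 := this
    linarith
  have hχ0 : ∀ y, y ∉ tsupport χ → χ y = 0 ∧ pd2 χ y = 0 := fun y hy =>
    ⟨image_eq_zero_of_notMem_tsupport hy,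
      image_eq_zero_of_notMem_tsupport fun h => hy (tsupport_pd2_subset χ h)⟩
  -- The line at height `-(R + 1)` lies strictly below the support of `χ`, so no boundary term can
  -- appear.
  have H : HasGraphTrace (fun _ => -(R + 1)) V D (fun _ => 0) := by
    refine ⟨locallyIntegrable_zero, fun K _ => hV.integrableOn, fun K _ => hD.integrableOn, ?_⟩
    intro θ hθ
    have hθd := hθ.1.differentiable (by simp)
    rw [setIntegral_eq_integral_of_forall_compl_eq_zero]
    swap
    · intro y hy
      have : y ∉ tsupport χ := fun h => hy (hpos y h)
      simp [hVdef, hDdef, hχ0 y this]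
    have ht := hχ.mul hθ.1
    have h1 := hw _ ht
    rw [setIntegral_eq_integral_of_forall_compl_eq_zero,
      setIntegral_eq_integral_of_forall_compl_eq_zero, eq_neg_iff_add_eq_zero,
      ← integral_add] at h1
    · simp only [zero_mul, integral_zero, neg_zero]
      rw [← h1]
      congr 1; ext y
      rw [pd2_mul hχd hθd]
      simp only [hVdef, hDdef]
      ring
    · exact integrableOn_mul_of_tsupport_subset hv (continuous_pd2 ht.1)
        (hasCompactSupport_pd2 ht.2.1) ((tsupport_pd2_subset _).trans ht.2.2)
    · exact integrableOn_mul_of_tsupport_subset hd ht.1.continuous ht.2.1 ht.2.2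
    · intro y hy
      have : y ∉ tsupport χ := fun h => hy (hχ.2.2 h)
      simp [hχ0 y this]
    · intro y hy
      have : y ∉ tsupport χ := fun h => hy (hχ.2.2 h)
      rw [pd2_mul hχd hθd]
      simp [hχ0 y this]
  have hφ0 : ∀ y, y ∉ tsupport φ → φ y = 0 ∧ pd2 φ y = 0 := fun y hy =>
    ⟨image_eq_zero_of_notMem_tsupport hy,
      image_eq_zero_of_notMem_tsupport fun h => hy (tsupport_pd2_subset φ h)⟩
  have hφ1 : ∀ y, y ∈ tsupport φ → V y = v y ∧ D y = d y := by
    intro y hy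
    have h1 : χ =ᶠ[nhds y] fun _ => 1 := hχ1 y hy
    have h2 : pd2 χ y = 0 := by simp [pd2, h1.fderiv_eq]
    simp [hVdef, hDdef, h1.eq_of_nhds, h2]
  have hsub : tsupport φ ⊆ tsupport χ := fun y hy => by
    apply subset_tsupport
    rw [Function.mem_support, (hχ1 y hy).self_of_nhds]
    exact one_ne_zero
  have key := (H.comp continuous_const (fun _ => le_rfl) hF hF' hb).green φ
    ⟨hφ.1, hφ.2.1, subset_univ _⟩
  have hline : ∀ t : ℝ, φ (t, -(R + 1)) = 0 := fun t => (hφ0 _ fun h => by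
    have := hpos _ (hsub h)
    simp at this).1
  simp only [hline, mul_zero, integral_zero, neg_zero] at key
  have hL := lipschitzWith_one_of_hasDerivAt hF hb
  have lv : LocallyIntegrableOn (fun y => F (v y)) Ω := by
    rw [locallyIntegrableOn_iff hΩ.isLocallyClosed]
    exact fun k hk hkc => IntegrableOn.lipschitz_comp hL (hv.integrableOn_compact_subset hk hkc)
      hkc.measure_lt_top.ne
  have ld : LocallyIntegrableOn (fun y => F' (v y) * d y) Ω := by
    rw [locallyIntegrableOn_iff hΩ.isLocallyClosed]
    exact fun k hk hkc => IntegrableOn.bounded_comp_mul hF' hb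
      (hv.integrableOn_compact_subset hk hkc).1 (hd.integrableOn_compact_subset hk hkc)
  rw [eq_neg_iff_add_eq_zero, setIntegral_eq_integral_of_forall_compl_eq_zero,
      setIntegral_eq_integral_of_forall_compl_eq_zero, ← integral_add]
  · rw [setIntegral_eq_integral_of_forall_compl_eq_zero] at key
    · rw [← key]
      congr 1; ext y
      by_cases hy : y ∈ tsupport φ
      · rw [(hφ1 y hy).1, (hφ1 y hy).2]
      · rw [(hφ0 y hy).1, (hφ0 y hy).2]; ring
    · intro y hy
      have : y ∉ tsupport φ := fun h => hy (hpos y (hsub h))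
      simp [hφ0 y this]
  · exact integrableOn_mul_of_tsupport_subset lv (continuous_pd2 hφ.1)
      (hasCompactSupport_pd2 hφ.2.1) ((tsupport_pd2_subset _).trans hφ.2.2)
  · exact integrableOn_mul_of_tsupport_subset ld hφ.1.continuous hφ.2.1 hφ.2.2
  · intro y hy
    simp [hφ0 y fun h => hy (hφ.2.2 h)]
  · intro y hy
    simp [hφ0 y fun h => hy (hφ.2.2 h)]

theorem pd2_comp_swap {φ : ℝ × ℝ → ℝ} (hφ : Differentiable ℝ φ) (y : ℝ × ℝ) :
    pd2 (φ ∘ Prod.swap) y = pd1 φ y.swap :=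
  (hasDerivAt_pd2 (hφ.comp (differentiable_snd.prodMk differentiable_fst)) y.1 y.2).unique (hasDerivAt_pd1 hφ y.2 y.1)

theorem IsTest.comp_swap {Ω : Set (ℝ × ℝ)} {φ : ℝ × ℝ → ℝ} (hφ : IsTest Ω φ) :
    IsTest (Prod.swap ⁻¹' Ω) (φ ∘ Prod.swap) := by
  refine ⟨hφ.1.comp (contDiff_snd.prodMk contDiff_fst), hφ.2.1.comp_homeomorph (Homeomorph.prodComm ℝ ℝ), ?_⟩
  have := tsupport_comp_eq_preimage φ (Homeomorph.prodComm ℝ ℝ)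
  exact this.subset.trans (preimage_mono hφ.2.2)

theorem integral_preimage_swap (Ω : Set (ℝ × ℝ)) (v : ℝ × ℝ → ℝ) :
    ∫ x in Prod.swap ⁻¹' Ω, v x.swap = ∫ x in Ω, v x :=
  (Measure.measurePreserving_swap (μ := (volume : Measure ℝ)) (ν := (volume : Measure ℝ)))
    |>.setIntegral_preimage_emb MeasurableEquiv.prodComm.measurableEmbedding v Ω

theorem LocallyIntegrableOn.comp_swap {Ω : Set (ℝ × ℝ)} (hΩ : IsOpen Ω) {v : ℝ × ℝ → ℝ}
    (hv : LocallyIntegrableOn v Ω) :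
    LocallyIntegrableOn (v ∘ Prod.swap) (Prod.swap ⁻¹' Ω) := by
  rw [locallyIntegrableOn_iff (hΩ.preimage continuous_swap).isLocallyClosed]
  intro k hk hkc
  have h := hv.integrableOn_compact_subset (t := Prod.swap '' k) (by
    rintro _ ⟨y, hy, rfl⟩
    exact hk hy) (hkc.image continuous_swap)
  have := (Measure.measurePreserving_swap (μ := (volume : Measure ℝ)) (ν := (volume : Measure ℝ)))
    |>.integrableOn_comp_preimage (MeasurableEquiv.prodComm.measurableEmbedding) (f := v)
      (s := Prod.swap '' k)
  have h2 := this.2 h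
  rwa [preimage_image_eq _ Prod.swap_injective] at h2

/-- The formula in `x₂` is already available; the one in `x₁` is its image under the exchange of
coordinates. -/
theorem HasWeakGradient.comp {Ω : Set (ℝ × ℝ)} (hΩ : IsOpen Ω) {v d1 d2 : ℝ × ℝ → ℝ}
    (H : HasWeakGradient Ω v d1 d2) {F F' : ℝ → ℝ} (hF : ∀ x, HasDerivAt F (F' x) x)
    (hF' : Continuous F') (hb : ∀ x, |F' x| ≤ 1) :
    HasWeakGradient Ω (fun y => F (v y)) (fun y => F' (v y) * d1 y) (fun y => F' (v y) * d2 y) := by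
  have hL := lipschitzWith_one_of_hasDerivAt hF hb
  have ld : ∀ d, LocallyIntegrableOn d Ω → LocallyIntegrableOn (fun y => F' (v y) * d y) Ω := by
    intro d hd
    rw [locallyIntegrableOn_iff hΩ.isLocallyClosed]
    exact fun k hk hkc => IntegrableOn.bounded_comp_mul hF' hb
      (H.locInt.integrableOn_compact_subset hk hkc).1 (hd.integrableOn_compact_subset hk hkc)
  refine ⟨?_, ld _ H.locInt_d1, ld _ H.locInt_d2, fun φ hφ => ?_, fun φ hφ =>
    weak_pd2_comp hΩ H.locInt H.locInt_d2 H.weak_d2 hF hF' hb hφ⟩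
  · rw [locallyIntegrableOn_iff hΩ.isLocallyClosed]
    exact fun k hk hkc => IntegrableOn.lipschitz_comp hL
      (H.locInt.integrableOn_compact_subset hk hkc) hkc.measure_lt_top.ne
  · have h := weak_pd2_comp (hΩ.preimage continuous_swap)
      (LocallyIntegrableOn.comp_swap hΩ H.locInt) (LocallyIntegrableOn.comp_swap hΩ H.locInt_d1)
      (fun θ hθ => by
        have hθ' : IsTest Ω (θ ∘ Prod.swap) := by
          have := hθ.comp_swap
          rwa [← preimage_comp, Prod.swap_swap_eq, preimage_id] at this
        have := H.weak_d1 _ hθ'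
        rw [← integral_preimage_swap Ω fun x => v x * pd1 (θ ∘ Prod.swap) x,
          ← integral_preimage_swap Ω fun x => d1 x * (θ ∘ Prod.swap) x] at this
        simp only [← pd2_comp_swap (hθ'.1.differentiable (by simp)), Function.comp_assoc,
          Prod.swap_swap_eq, Function.comp_id, Function.comp_apply, Prod.swap_swap] at this
        exact this) hF hF' hb hφ.comp_swap
    simp only [pd2_comp_swap (hφ.1.differentiable (by simp)), Function.comp] at h
    rwa [integral_preimage_swap Ω fun x => F (v x) * pd1 φ x,
      integral_preimage_swap Ω fun x => F' (v x) * d1 x * φ x] at h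

/-! ### The maximum principle for the cell problems -/

theorem cell_subset_above (f : ℝ → ℝ) : cell f ⊆ above f := fun _ hy => hy.2

theorem measurableSet_cell {f : ℝ → ℝ} (hf : Continuous f) : MeasurableSet (cell f) :=
  (measurable_fst measurableSet_Ioo).inter (isOpen_above hf).measurableSet

/-- Composition of an element of `D12` with a function of bounded continuous derivative. -/
noncomputable def D12.comp {f : ℝ → ℝ} (hf : Continuous f) (b : D12 f) {F F' : ℝ → ℝ}
    (hF : ∀ x, HasDerivAt F (F' x) x) (hF' : Continuous F') (hb : ∀ x, |F' x| ≤ 1) : D12 f where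
  toFun y := F (b.toFun y)
  d1 y := F' (b.toFun y) * b.d1 y
  d2 y := F' (b.toFun y) * b.d2 y
  periodic t s := by simp only; rw [b.periodic t s]
  periodic_d1 t s := by simp only; rw [b.periodic t s, b.periodic_d1 t s]
  periodic_d2 t s := by simp only; rw [b.periodic t s, b.periodic_d2 t s]
  weak := b.weak.comp (isOpen_above hf) hF hF' hb
  memLp_d1 := by
    refine b.memLp_d1.mono ((hF'.comp_aestronglyMeasurable
      (b.weak.locInt.aestronglyMeasurable.mono_set (cell_subset_above f))).mul b.memLp_d1.1)
      (Filter.Eventually.of_forall fun y => ?_)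
    rw [norm_mul]
    exact mul_le_of_le_one_left (norm_nonneg _) (hb _)
  memLp_d2 := by
    refine b.memLp_d2.mono ((hF'.comp_aestronglyMeasurable
      (b.weak.locInt.aestronglyMeasurable.mono_set (cell_subset_above f))).mul b.memLp_d2.1)
      (Filter.Eventually.of_forall fun y => ?_)
    rw [norm_mul]
    exact mul_le_of_le_one_left (norm_nonneg _) (hb _)

/-- This is a `C¹` replacement for the positive part of `x - c`: its derivative is `x - c` clipped
to `[0, 1]`, so that the chain rules for `C¹` functions with `|F'| ≤ 1` apply. -/
theorem exists_truncation (c : ℝ) : ∃ F F' : ℝ → ℝ, (∀ x, HasDerivAt F (F' x) x) ∧ Continuous F' ∧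
    (∀ x, |F' x| ≤ 1) ∧ (∀ x, 0 ≤ F' x) ∧ (∀ x ≤ c, F x = 0) ∧ ∀ x, c < x → 0 < F x := by
  set F' : ℝ → ℝ := fun x => min (max (x - c) 0) 1 with hdef
  have hc : Continuous F' := by fun_prop
  have h0 : ∀ x, 0 ≤ F' x := fun x => le_min (le_max_right _ _) zero_le_one
  refine ⟨fun x => ∫ s in c..x, F' s, F', fun x => ?_, hc, fun x => ?_, h0, ?_, ?_⟩
  · exact intervalIntegral.integral_hasDerivAt_right (hc.intervalIntegrable _ _)
      hc.stronglyMeasurable.stronglyMeasurableAtFilter hc.continuousAt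
  · rw [abs_of_nonneg (h0 x)]
    exact min_le_right _ _
  · intro x hx
    refine (intervalIntegral.integral_congr fun s hs => ?_).trans intervalIntegral.integral_zero
    rw [uIcc_of_ge hx] at hs
    simp [hdef, hs.2]
  · intro x hx
    refine intervalIntegral.intervalIntegral_pos_of_pos_on (hc.intervalIntegrable _ _)
      (fun s hs => ?_) hx
    exact lt_min (lt_max_of_lt_left (by linarith [hs.1])) one_pos

/-- Weak maximum principle. The truncation `F(b)` has zero trace because the data do not exceed `c`;
testing with it kills `F'(b)∇b`. Integrating the vertical derivative up from the graph then gives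
`F(b) = 0`, so neither connectedness nor a Poincaré inequality on the unbounded cell is needed. -/
theorem IsCellSolution.ae_le {f g : ℝ → ℝ} (hf : Continuous f) {m : ℝ} (hm : ∀ t, m ≤ f t)
    {b : D12 f} (H : IsCellSolution f g b) {c : ℝ} (hg : ∀ t, g t ≤ c) :
    ∀ᵐ t : ℝ, ∀ᵐ s : ℝ, (t, s) ∈ cell f → b.toFun (t, s) ≤ c := by
  obtain ⟨F, F', hF, hF', hb, hpos, hF0, hF1⟩ := exists_truncation c
  have htr := H.1.comp hf hm hF hF' hb
  have hg0 : (fun t => F (g t)) = fun _ => 0 := funext fun t => hF0 _ (hg t)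
  rw [hg0] at htr
  have hint := H.2 (b.comp hf hF hF' hb) htr
  simp only [D12.comp] at hint
  have hmem1 := (b.comp hf hF hF' hb).memLp_d1
  have hmem2 := (b.comp hf hF hF' hb).memLp_d2
  have hI : Integrable (fun y => b.d1 y * (F' (b.toFun y) * b.d1 y) +
      b.d2 y * (F' (b.toFun y) * b.d2 y)) (volume.restrict (cell f)) :=
    (b.memLp_d1.integrable_mul hmem1).add (b.memLp_d2.integrable_mul hmem2)
  have h0 := (integral_eq_zero_iff_of_nonneg (fun y => by
    have := hpos (b.toFun y)
    have e : b.d1 y * (F' (b.toFun y) * b.d1 y) + b.d2 y * (F' (b.toFun y) * b.d2 y) =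
      F' (b.toFun y) * (b.d1 y ^ 2 + b.d2 y ^ 2) := by ring
    simp only [Pi.zero_apply, e]
    positivity) hI).1 hint
  have hd : ∀ᵐ y : ℝ × ℝ, y ∈ cell f → F' (b.toFun y) * b.d2 y = 0 := by
    rw [← ae_restrict_iff' (measurableSet_cell hf)]
    filter_upwards [h0] with y hy
    simp only [Pi.zero_apply] at hy
    have e : F' (b.toFun y) * b.d1 y ^ 2 + F' (b.toFun y) * b.d2 y ^ 2 = 0 := by linarith
    have p1 := mul_nonneg (hpos (b.toFun y)) (sq_nonneg (b.d1 y))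
    have p2 := mul_nonneg (hpos (b.toFun y)) (sq_nonneg (b.d2 y))
    have : F' (b.toFun y) * b.d2 y ^ 2 = 0 := by linarith
    rcases mul_eq_zero.1 this with h | h
    · rw [h, zero_mul]
    · rw [pow_eq_zero_iff (by norm_num)] at h
      rw [h, mul_zero]
  have hrep := htr.ae_eq_primitive hf hm
  rw [Measure.volume_eq_prod] at hd hrep
  filter_upwards [Measure.ae_ae_of_ae_prod hd, Measure.ae_ae_of_ae_prod hrep] with t h1 h2
  filter_upwards [h2] with s hs hmem
  have h3 := hs hmem.2
  have h4 : ∫ r in f t..s, F' (b.toFun (t, r)) * b.d2 (t, r) = 0 := by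
    rw [intervalIntegral.integral_of_le (le_of_lt hmem.2)]
    refine integral_eq_zero_of_ae ?_
    rw [Filter.EventuallyEq, ae_restrict_iff' measurableSet_Ioc]
    filter_upwards [h1] with r hr hr'
    exact hr ⟨hmem.1, hr'.1⟩
  simp only [zero_add] at h3
  rw [h4] at h3
  by_contra hlt
  exact (hF1 _ (not_le.1 hlt)).ne' h3

/-- The bound above the graph is only almost everywhere, while the trace lives on a null line. On
almost every vertical line the solution is continuous in `s` with limit `η t` as `s` decreases to
`0`; if `η t > c`, it would exceed `c` on an interval of positive length. -/
theorem IsCellSolution.interfaceMean_le {f g : ℝ → ℝ} (hf : Continuous f) {m : ℝ}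
    (hm : ∀ t, m ≤ f t) (hneg : ∀ t, f t < 0) {b : D12 f} (H : IsCellSolution f g b) {c : ℝ}
    (hg : ∀ t, g t ≤ c) {M : ℝ} (hM : HasInterfaceMean b M) : M ≤ c := by
  obtain ⟨η, hη, rfl⟩ := hM
  have hrep := hη.ae_eq_primitive continuous_const (fun _ => le_rfl)
  rw [Measure.volume_eq_prod] at hrep
  have hηc : ∀ᵐ t : ℝ, t ∈ Ioo 0 (2 * Real.pi) → η t ≤ c := by
    filter_upwards [H.ae_le hf hm hg, Measure.ae_ae_of_ae_prod hrep,
      ae_integrableOn_line (locallyIntegrable_indicator_above continuous_const hη.int_d2)]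
      with t h1 h2 h3 ht
    by_contra hlt
    have hdt : IntervalIntegrable (fun s => b.d2 (t, s)) volume 0 1 := by
      rw [intervalIntegrable_iff_integrableOn_Ioc_of_le zero_le_one]
      refine ((h3 0 1).mono_set Ioc_subset_Icc_self).congr_fun (fun s hs => ?_)
        measurableSet_Ioc
      exact indicator_of_mem (show (t, s) ∈ above fun _ => 0 from hs.1) _
    have hcont : ContinuousOn (fun s => η t + ∫ r in (0 : ℝ)..s, b.d2 (t, r)) (Icc 0 1) := by
      have := intervalIntegral.continuousOn_primitive_interval (a := (0 : ℝ)) (b := 1)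
        (f := fun s => b.d2 (t, s)) (μ := volume) ((intervalIntegrable_iff' (by simp)).1 hdt)
      rw [uIcc_of_le zero_le_one] at this
      exact continuousOn_const.add this
    have h0 := (hcont 0 (by simp)).tendsto
    simp only [intervalIntegral.integral_same, add_zero] at h0
    have hev := h0.eventually (lt_mem_nhds (not_le.1 hlt))
    rw [nhdsWithin_Icc_eq_nhdsGE zero_lt_one] at hev
    obtain ⟨ε, hε, hsub⟩ := (mem_nhdsGE_iff_exists_Ico_subset.1 hev)
    have hbad : ∀ᵐ s : ℝ, s ∉ Ioo 0 ε := by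
      filter_upwards [h1, h2] with s hs1 hs2 hs
      have e1 := hs2 (show (t, s) ∈ above fun _ => 0 from hs.1)
      have e2 := hs1 ⟨ht, (hneg t).trans hs.1⟩
      have e3 : c < η t + ∫ r in (0 : ℝ)..s, b.d2 (t, r) := hsub ⟨hs.1.le, hs.2⟩
      linarith
    have hz : volume (Ioo 0 ε) = 0 := by
      rw [measure_eq_zero_iff_ae_notMem]
      exact hbad
    rw [Real.volume_Ioo, ENNReal.ofReal_eq_zero] at hz
    have : (0 : ℝ) < ε := hε
    linarith
  have hpi := Real.two_pi_pos
  have hle : ∫ t in (0 : ℝ)..(2 * Real.pi), η t ≤ ∫ t in (0 : ℝ)..(2 * Real.pi), c := by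
    rw [intervalIntegral.integral_of_le hpi.le, intervalIntegral.integral_of_le hpi.le,
      integral_Ioc_eq_integral_Ioo, integral_Ioc_eq_integral_Ioo]
    refine integral_mono_ae ?_ ?_ ((ae_restrict_iff' measurableSet_Ioo).2 hηc)
    · exact (hη.locInt.integrableOn_isCompact (isCompact_Icc (a := 0) (b := 2 * Real.pi))).mono_set
        Ioo_subset_Icc_self
    · exact integrableOn_const measure_Ioo_lt_top.ne
  rw [intervalIntegral.integral_const, smul_eq_mul, sub_zero] at hle
  rw [one_div, inv_mul_le_iff₀ hpi]
  exact hle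

/-- The opposite of an element of `D12`. -/
def D12.neg {f : ℝ → ℝ} (b : D12 f) : D12 f where
  toFun y := -b.toFun y
  d1 y := -b.d1 y
  d2 y := -b.d2 y
  periodic t s := by simp only; rw [b.periodic t s]
  periodic_d1 t s := by simp only; rw [b.periodic_d1 t s]
  periodic_d2 t s := by simp only; rw [b.periodic_d2 t s]
  weak := by
    refine ⟨b.weak.locInt.neg, b.weak.locInt_d1.neg, b.weak.locInt_d2.neg, fun φ hφ => ?_,
      fun φ hφ => ?_⟩
    · simp only [neg_mul, integral_neg, b.weak.weak_d1 φ hφ]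
    · simp only [neg_mul, integral_neg, b.weak.weak_d2 φ hφ]
  memLp_d1 := b.memLp_d1.neg
  memLp_d2 := b.memLp_d2.neg

theorem HasGraphTrace.neg {h : ℝ → ℝ} {v d g} (H : HasGraphTrace h v d g) :
    HasGraphTrace h (fun y => -v y) (fun y => -d y) (fun t => -g t) := by
  refine ⟨H.locInt.neg, fun K hK => (H.int_v K hK).neg, fun K hK => (H.int_d2 K hK).neg,
    fun φ hφ => ?_⟩
  simp only [neg_mul, ← neg_add, integral_neg, H.green φ hφ]

theorem IsCellSolution.neg {f g : ℝ → ℝ} {b : D12 f} (H : IsCellSolution f g b) :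
    IsCellSolution f (fun t => -g t) b.neg := by
  refine ⟨H.1.neg, fun v hv => ?_⟩
  simp only [D12.neg, neg_mul, ← neg_add, integral_neg, H.2 v hv, neg_zero]

theorem HasInterfaceMean.neg {f : ℝ → ℝ} {b : D12 f} {M : ℝ} (H : HasInterfaceMean b M) :
    HasInterfaceMean b.neg (-M) := by
  obtain ⟨η, hη, rfl⟩ := H
  exact ⟨fun t => -η t, hη.neg, by rw [intervalIntegral.integral_neg]; ring⟩

/-! ### Unfolding integrals of periodic functions -/

/-- The test functions used for unfolding spread over exactly two consecutive periods, so a single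
translate suffices. -/
theorem integral_eq_add_translate {α : Type*} [MeasurableSpace α] {μ : Measure α} {T : α → α}
    (hT : MeasurePreserving T μ μ) (hTe : MeasurableEmbedding T) {A : Set α} (hA : MeasurableSet A)
    (hd : Disjoint A (T '' A)) {F : α → ℝ} (h0 : ∀ᵐ x ∂μ, x ∉ A ∪ T '' A → F x = 0)
    (h1 : IntegrableOn F A μ) (h2 : IntegrableOn (F ∘ T) A μ) :
    Integrable F μ ∧ ∫ x, F x ∂μ = ∫ x in A, (F x + F (T x)) ∂μ := by
  have hTA : MeasurableSet (T '' A) := hTe.measurableSet_image.2 hA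
  have h2' : IntegrableOn F (T '' A) μ := (hT.integrableOn_image hTe).2 h2
  have hi : IntegrableOn F (A ∪ T '' A) μ := h1.union h2'
  have hF : F =ᵐ[μ] (A ∪ T '' A).indicator F := by
    filter_upwards [h0] with x hx
    by_cases h : x ∈ A ∪ T '' A
    · rw [indicator_of_mem h]
    · rw [indicator_of_notMem h, hx h]
  refine ⟨(hi.integrable_indicator (hA.union hTA)).congr hF.symm, ?_⟩
  rw [integral_congr_ae hF, integral_indicator (hA.union hTA), setIntegral_union hd hTA h1 h2',
    hT.setIntegral_image_emb hTe]
  exact (integral_add h1 h2).symm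

theorem ae_ne_three (L : ℝ) : ∀ᵐ x : ℝ, x ≠ 0 ∧ x ≠ L ∧ x ≠ 2 * L := by
  filter_upwards [Measure.ae_ne volume (0 : ℝ), Measure.ae_ne volume L,
    Measure.ae_ne volume (2 * L)] with x h1 h2 h3 using ⟨h1, h2, h3⟩

theorem ae_fst {p : ℝ → Prop} (h : ∀ᵐ t : ℝ, p t) : ∀ᵐ y : ℝ × ℝ, p y.1 := by
  rw [Measure.volume_eq_prod]
  exact Measure.quasiMeasurePreserving_fst.ae h

theorem measurePreserving_shift (L : ℝ) :
    MeasurePreserving (fun x : ℝ × ℝ => (x.1 + L, x.2)) :=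
  (measurePreserving_add_right volume L).prod (MeasurePreserving.id volume)

theorem measurableEmbedding_shift (L : ℝ) :
    MeasurableEmbedding (fun x : ℝ × ℝ => (x.1 + L, x.2)) :=
  (measurableEmbedding_addRight L).prodMap MeasurableEmbedding.id

theorem isOpen_Omega0 (L : ℝ) : IsOpen (Omega0 L) := isOpen_Ioo.prod isOpen_Ioo

theorem isOpen_strip : IsOpen strip := isOpen_univ.prod isOpen_Ioo

theorem Omega0_subset_strip (L : ℝ) : Omega0 L ⊆ strip := fun _ hx => ⟨mem_univ _, hx.2⟩

theorem volume_Omega0_ne_top (L : ℝ) : volume (Omega0 L) ≠ ⊤ := by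
  rw [Omega0, Measure.volume_eq_prod, Measure.prod_prod]
  exact ENNReal.mul_ne_top (by simp) (by simp)

theorem integral_unfold_line {L : ℝ} {ρ a g : ℝ → ℝ} (hρ : Continuous ρ)
    (hρ0 : ∀ x, x ∉ Icc 0 (2 * L) → ρ x = 0) (hs : ∀ x ∈ Ioo 0 L, ρ x + ρ (x + L) = a x)
    (hg : Function.Periodic g L)
    (hgi : IntegrableOn g (Ioo 0 L)) :
    ∫ t, g t * ρ t = ∫ t in Ioo 0 L, g t * a t := by
  have hc : HasCompactSupport ρ := HasCompactSupport.of_support_subset_isCompact isCompact_Icc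
    (fun x hx => by_contra fun h => hx (hρ0 x h))
  obtain ⟨M, hM⟩ := hc.exists_bound_of_continuous hρ
  have := (integral_eq_add_translate (measurePreserving_add_right volume L)
    (measurableEmbedding_addRight L) (A := Ioo 0 L) measurableSet_Ioo ?_
    (F := fun t => g t * ρ t) ?_ ?_ ?_).2
  · rw [this]
    refine setIntegral_congr_fun measurableSet_Ioo fun t ht => ?_
    simp only [hg t, ← hs t ht]
    ring
  · rw [image_add_const_Ioo]
    exact disjoint_left.2 fun x h1 h2 => by linarith [h1.2, h2.1]
  · filter_upwards [ae_ne_three L] with x hx hxm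
    rw [image_add_const_Ioo, zero_add] at hxm
    by_cases h : x ∈ Icc 0 (2 * L)
    · exfalso
      apply hxm
      rcases lt_or_gt_of_ne hx.2.1 with h' | h'
      · exact Or.inl ⟨lt_of_le_of_ne h.1 hx.1.symm, h'⟩
      · exact Or.inr ⟨h', lt_of_le_of_ne (by linarith [h.2]) (by
          intro e; exact hx.2.2 (by linarith))⟩
    · simp [hρ0 x h]
  · exact Integrable.mul_bdd hgi hρ.aestronglyMeasurable (Filter.Eventually.of_forall hM)
  · have : ((fun t => g t * ρ t) ∘ fun x => x + L) = fun t => g t * ρ (t + L) := by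
      ext t; simp [hg t]
    rw [this]
    exact Integrable.mul_bdd hgi (hρ.comp (by fun_prop)).aestronglyMeasurable
      (Filter.Eventually.of_forall fun t => hM _)

theorem integral_unfold_strip {L : ℝ} {ρ a q : ℝ → ℝ} (hρ : Continuous ρ)
    (hρ0 : ∀ x, x ∉ Icc 0 (2 * L) → ρ x = 0) (hs : ∀ x ∈ Ioo 0 L, ρ x + ρ (x + L) = a x)
    (hq : Continuous q) {P : ℝ × ℝ → ℝ}
    (hP : PeriodicX1 L P) (hPi : IntegrableOn P (Omega0 L)) :
    IntegrableOn (fun x => P x * (ρ x.1 * q x.2)) strip ∧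
    ∫ x in strip, P x * (ρ x.1 * q x.2) =
      ∫ x in Omega0 L, P x * (a x.1 * q x.2) := by
  have hc : HasCompactSupport ρ := HasCompactSupport.of_support_subset_isCompact isCompact_Icc
    (fun x hx => by_contra fun h => hx (hρ0 x h))
  obtain ⟨M, hM⟩ := hc.exists_bound_of_continuous hρ
  obtain ⟨M', hM'⟩ := (isCompact_Icc (a := (0 : ℝ)) (b := 1)).exists_bound_of_continuousOn
    hq.continuousOn
  have hΩ := (isOpen_Omega0 L).measurableSet
  have hbd : ∀ a : ℝ, IntegrableOn (fun x : ℝ × ℝ => P x * (ρ (x.1 + a) * q x.2)) (Omega0 L) := by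
    intro a
    refine Integrable.mul_bdd (c := M * M') hPi
      (by fun_prop : Continuous fun x : ℝ × ℝ => ρ (x.1 + a) * q x.2).aestronglyMeasurable ?_
    refine (ae_restrict_iff' hΩ).2 (Filter.Eventually.of_forall fun x hx => ?_)
    rw [norm_mul]
    have h1 := hM (x.1 + a)
    exact mul_le_mul h1 (hM' _ ⟨hx.2.1.le, hx.2.2.le⟩) (norm_nonneg _) ((norm_nonneg _).trans h1)
  have himg : (fun x : ℝ × ℝ => (x.1 + L, x.2)) '' Omega0 L = Ioo L (2 * L) ×ˢ Ioo 0 1 := by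
    have := prodMap_image_prod (fun x : ℝ => x + L) (fun x : ℝ => x) (Ioo 0 L) (Ioo 0 1)
    rw [image_add_const_Ioo, zero_add, ← two_mul, image_id'] at this
    exact this
  have key := integral_eq_add_translate (measurePreserving_shift L) (measurableEmbedding_shift L)
    (A := Omega0 L) hΩ ?_ (F := strip.indicator fun x => P x * (ρ x.1 * q x.2)) ?_ ?_ ?_
  · refine ⟨(integrable_indicator_iff isOpen_strip.measurableSet).1 key.1, ?_⟩
    rw [← integral_indicator isOpen_strip.measurableSet, key.2]
    refine setIntegral_congr_fun hΩ fun x hx => ?_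
    have h1 : x ∈ strip := Omega0_subset_strip L hx
    have h2 : (x.1 + L, x.2) ∈ strip := ⟨mem_univ _, hx.2⟩
    simp only [indicator_of_mem h1, indicator_of_mem h2, hP x.1 x.2, ← hs x.1 hx.1]
    ring
  · rw [himg]
    exact disjoint_left.2 fun x h1 h2 => by linarith [h1.1.2, h2.1.1]
  · filter_upwards [ae_fst (ae_ne_three L)] with x hx hxm
    rw [himg] at hxm
    by_cases hs : x ∈ strip
    · rw [indicator_of_mem hs]
      by_cases h : x.1 ∈ Icc 0 (2 * L)
      · exfalso
        apply hxm
        rcases lt_or_gt_of_ne hx.2.1 with h' | h'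
        · exact Or.inl ⟨⟨lt_of_le_of_ne h.1 hx.1.symm, h'⟩, hs.2⟩
        · exact Or.inr ⟨⟨h', lt_of_le_of_ne h.2 hx.2.2⟩, hs.2⟩
      · simp [hρ0 x.1 h]
    · rw [indicator_of_notMem hs]
  · refine IntegrableOn.congr_fun (hbd 0) (fun x hx => ?_) hΩ
    rw [indicator_of_mem (Omega0_subset_strip L hx), add_zero]
  · refine IntegrableOn.congr_fun (hbd L) (fun x hx => ?_) hΩ
    simp only [Function.comp]
    rw [indicator_of_mem (show (x.1 + L, x.2) ∈ strip from ⟨mem_univ _, hx.2⟩), hP x.1 x.2]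

/-- The equations are tested with compactly supported functions, but periodic ones are needed. The
factor `S(x/L) - S(x/L - 1)` is supported in two periods, and its sum with its translate by `L`
telescopes to `1` on `(0, L)`. -/
theorem exists_unfolding {L : ℝ} (hL : 0 < L) {a : ℝ → ℝ} (ha : ContDiff ℝ ∞ a)
    (hp : Function.Periodic a L) :
    ∃ ρ : ℝ → ℝ, ContDiff ℝ ∞ ρ ∧ (∀ x, x ∉ Icc 0 (2 * L) → ρ x = 0) ∧
      (∀ x, x ∉ Icc 0 (2 * L) → deriv ρ x = 0) ∧
      (∀ x ∈ Ioo 0 L, ρ x + ρ (x + L) = a x) ∧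
      ∀ x ∈ Ioo 0 L, deriv ρ x + deriv ρ (x + L) = deriv a x := by
  set S := Real.smoothTransition
  set ρ : ℝ → ℝ := fun x => (S (x / L) - S (x / L - 1)) * a x with hdef
  have hS : ContDiff ℝ ∞ S := Real.smoothTransition.contDiff
  have hρ : ContDiff ℝ ∞ ρ :=
    ((hS.comp (by fun_prop)).sub (hS.comp (by fun_prop))).mul ha
  have h0 : ∀ x, x ∉ Icc 0 (2 * L) → ρ x = 0 := by
    intro x hx
    rcases lt_or_ge x 0 with h | h
    · have h1 : x / L ≤ 0 := div_nonpos_of_nonpos_of_nonneg h.le hL.le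
      simp [hdef, S, Real.smoothTransition.zero_of_nonpos h1,
        Real.smoothTransition.zero_of_nonpos (show x / L - 1 ≤ 0 by linarith)]
    · have h1 : 2 ≤ x / L := by
        rw [le_div_iff₀ hL]
        by_contra hlt
        exact hx ⟨h, by linarith⟩
      simp [hdef, S, Real.smoothTransition.one_of_one_le (show 1 ≤ x / L by linarith),
        Real.smoothTransition.one_of_one_le (show 1 ≤ x / L - 1 by linarith)]
  have hsum : ∀ x ∈ Ioo 0 L, ρ x + ρ (x + L) = a x := by
    intro x hx
    have e : (x + L) / L = x / L + 1 := by field_simp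
    have h1 : 0 ≤ x / L := div_nonneg hx.1.le hL.le
    have h2 : x / L ≤ 1 := by rw [div_le_one hL]; exact hx.2.le
    simp only [hdef, e, hp x, add_sub_cancel_right]
    rw [show S (x / L - 1) = 0 from Real.smoothTransition.zero_of_nonpos (by linarith),
      show S (x / L + 1) = 1 from Real.smoothTransition.one_of_one_le (by linarith)]
    ring
  have hdiff : Differentiable ℝ ρ := hρ.differentiable (by simp)
  refine ⟨ρ, hρ, h0, fun x hx => ?_, hsum, fun x hx => ?_⟩
  · have : ρ =ᶠ[nhds x] fun _ => 0 := by
      filter_upwards [isClosed_Icc.isOpen_compl.mem_nhds hx] with y hy using h0 y hy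
    rw [this.deriv_eq, deriv_const]
  · have h1 : HasDerivAt (fun y => ρ y + ρ (y + L)) (deriv ρ x + deriv ρ (x + L)) x :=
      (hdiff x).hasDerivAt.add ((hdiff (x + L)).hasDerivAt.comp_add_const x L)
    have h2 : (fun y => ρ y + ρ (y + L)) =ᶠ[nhds x] a := by
      filter_upwards [isOpen_Ioo.mem_nhds hx] with y hy using hsum y hy
    rw [← h1.deriv, h2.deriv_eq]

/-! ### Product test functions -/

theorem isTest_prod {ρ b : ℝ → ℝ} {R : ℝ} (hρ : ContDiff ℝ ∞ ρ) (hρ0 : ∀ x, x ∉ Icc 0 R → ρ x = 0)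
    (hb : ContDiff ℝ ∞ b) (hbc : HasCompactSupport b) {I : Set ℝ} (hbI : tsupport b ⊆ I) :
    IsTest (univ ×ˢ I) (fun x => ρ x.1 * b x.2) := by
  have hsub : tsupport (fun x : ℝ × ℝ => ρ x.1 * b x.2) ⊆ Icc 0 R ×ˢ tsupport b := by
    refine closure_minimal (fun x hx => ?_) (isClosed_Icc.prod (isClosed_tsupport b))
    exact ⟨by_contra fun h => left_ne_zero_of_mul hx (hρ0 _ h),
      subset_tsupport _ (right_ne_zero_of_mul hx)⟩
  refine ⟨(hρ.comp contDiff_fst).mul (hb.comp contDiff_snd), ?_, ?_⟩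
  · exact (isCompact_Icc.prod hbc.isCompact).of_isClosed_subset (isClosed_tsupport _) hsub
  · exact hsub.trans (prod_mono (subset_univ _) hbI)

theorem pd1_prod {ρ b : ℝ → ℝ} (hρ : ContDiff ℝ ∞ ρ) (hb : ContDiff ℝ ∞ b) (x : ℝ × ℝ) :
    pd1 (fun x => ρ x.1 * b x.2) x = deriv ρ x.1 * b x.2 := by
  have h : ContDiff ℝ ∞ (fun x : ℝ × ℝ => ρ x.1 * b x.2) :=
    (hρ.comp contDiff_fst).mul (hb.comp contDiff_snd)
  refine (hasDerivAt_pd1 (h.differentiable (by simp)) x.1 x.2).unique ?_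
  exact (hρ.differentiable (by simp) x.1).hasDerivAt.mul_const (b x.2)

theorem pd2_prod {ρ b : ℝ → ℝ} (hρ : ContDiff ℝ ∞ ρ) (hb : ContDiff ℝ ∞ b) (x : ℝ × ℝ) :
    pd2 (fun x => ρ x.1 * b x.2) x = ρ x.1 * deriv b x.2 := by
  have h : ContDiff ℝ ∞ (fun x : ℝ × ℝ => ρ x.1 * b x.2) :=
    (hρ.comp contDiff_fst).mul (hb.comp contDiff_snd)
  refine (hasDerivAt_pd2 (h.differentiable (by simp)) x.1 x.2).unique ?_
  exact (hb.differentiable (by simp) x.2).hasDerivAt.const_mul (ρ x.1)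

namespace H11

variable {L : ℝ} (u : H11 L)

theorem integrableOn_toFun : IntegrableOn u.toFun (Omega0 L) :=
  haveI : IsFiniteMeasure (volume.restrict (Omega0 L)) :=
    isFiniteMeasure_restrict.2 (volume_Omega0_ne_top L)
  u.memLp.integrable (by norm_num)

theorem integrableOn_d1 : IntegrableOn u.d1 (Omega0 L) :=
  haveI : IsFiniteMeasure (volume.restrict (Omega0 L)) :=
    isFiniteMeasure_restrict.2 (volume_Omega0_ne_top L)
  u.memLp_d1.integrable (by norm_num)

theorem integrableOn_d2 : IntegrableOn u.d2 (Omega0 L) :=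
  haveI : IsFiniteMeasure (volume.restrict (Omega0 L)) :=
    isFiniteMeasure_restrict.2 (volume_Omega0_ne_top L)
  u.memLp_d2.integrable (by norm_num)

theorem integrableOn_tr : IntegrableOn u.tr (Ioo 0 L) :=
  haveI : IsFiniteMeasure (volume.restrict (Ioo 0 L)) :=
    isFiniteMeasure_restrict.2 measure_Ioo_lt_top.ne
  u.memLp_tr.integrable (by norm_num)

/-- Integration by parts in `x₁` against periodic functions. -/
theorem integral_mul_deriv_fst (hL : 0 < L) {a b : ℝ → ℝ} (ha : ContDiff ℝ ∞ a)
    (hp : Function.Periodic a L) (hb : ContDiff ℝ ∞ b) (hbc : HasCompactSupport b)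
    (hbI : tsupport b ⊆ Ioo 0 1) :
    ∫ x in Omega0 L, u.toFun x * (deriv a x.1 * b x.2) =
      -∫ x in Omega0 L, u.d1 x * (a x.1 * b x.2) := by
  obtain ⟨ρ, hρ, hρ0, hρ0', hs, hs'⟩ := exists_unfolding hL ha hp
  have h := u.weak.weak_d1 _ (isTest_prod hρ hρ0 hb hbc hbI)
  simp only [pd1_prod hρ hb] at h
  rw [(integral_unfold_strip (hρ.continuous_deriv (by simp)) hρ0' hs' hb.continuous u.periodic
    u.integrableOn_toFun).2, (integral_unfold_strip hρ.continuous hρ0 hs hb.continuous u.periodic_d1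
    u.integrableOn_d1).2] at h
  exact h

/-- The Gauss-Green formula in `x₂` against periodic functions. -/
theorem integral_green (hL : 0 < L) {a b : ℝ → ℝ} (ha : ContDiff ℝ ∞ a)
    (hp : Function.Periodic a L) (hb : ContDiff ℝ ∞ b) (hbc : HasCompactSupport b) :
    (∫ x in Omega0 L, u.toFun x * (a x.1 * deriv b x.2)) +
      ∫ x in Omega0 L, u.d2 x * (a x.1 * b x.2) = -(b 0 * ∫ t in Ioo 0 L, u.tr t * a t) := by
  obtain ⟨ρ, hρ, hρ0, -, hs, -⟩ := exists_unfolding hL ha hp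
  have ht := isTest_prod hρ hρ0 hb hbc (subset_univ _)
  rw [univ_prod_univ] at ht
  have h := u.traces.green _ ht
  simp only [pd2_prod hρ hb] at h
  have h1 := integral_unfold_strip hρ.continuous hρ0 hs (hb.continuous_deriv (by simp)) u.periodic
    u.integrableOn_toFun
  have h2 := integral_unfold_strip hρ.continuous hρ0 hs hb.continuous u.periodic_d2
    u.integrableOn_d2
  rw [integral_add h1.1 h2.1, h1.2, h2.2] at h
  simp only [zero_mul, integral_zero, zero_sub] at h
  rw [h]
  simp only [← mul_assoc]
  rw [integral_mul_const, integral_unfold_line hρ.continuous hρ0 hs u.periodic_tr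
    u.integrableOn_tr]
  ring

/-- The Poisson equation against periodic functions. -/
theorem integral_poisson {C : ℝ} (hu : SolvesPoisson C u) (hL : 0 < L) {a b : ℝ → ℝ}
    (ha : ContDiff ℝ ∞ a) (hp : Function.Periodic a L) (hb : ContDiff ℝ ∞ b)
    (hbc : HasCompactSupport b) (hbI : tsupport b ⊆ Ioo 0 1) :
    (∫ x in Omega0 L, u.d1 x * (deriv a x.1 * b x.2)) +
      ∫ x in Omega0 L, u.d2 x * (a x.1 * deriv b x.2) = C * ∫ x in Omega0 L, a x.1 * b x.2 := by
  obtain ⟨ρ, hρ, hρ0, hρ0', hs, hs'⟩ := exists_unfolding hL ha hp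
  have h := hu _ (isTest_prod hρ hρ0 hb hbc hbI)
  simp only [pd1_prod hρ hb, pd2_prod hρ hb] at h
  have h1 := integral_unfold_strip (hρ.continuous_deriv (by simp)) hρ0' hs' hb.continuous
    u.periodic_d1 u.integrableOn_d1
  have h2 := integral_unfold_strip hρ.continuous hρ0 hs (hb.continuous_deriv (by simp))
    u.periodic_d2 u.integrableOn_d2
  have h3 := integral_unfold_strip hρ.continuous hρ0 hs hb.continuous
    (P := fun _ => 1) (fun _ _ => rfl) (integrableOn_const (volume_Omega0_ne_top L))
  simp only [one_mul] at h3
  rw [integral_add h1.1 h2.1, h1.2, h2.2, h3.2] at h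
  exact h

end H11

/-! ### Elements of `H11` depending on `x₂` only -/

theorem integral_strip_green {P : ℝ → ℝ} (hP : ContDiff ℝ ∞ P) {φ : ℝ × ℝ → ℝ}
    (hφ : IsTest univ φ) :
    ∫ x in strip, (P x.2 * pd2 φ x + deriv P x.2 * φ x) =
      (∫ t : ℝ, P 1 * φ (t, 1)) - ∫ t : ℝ, P 0 * φ (t, 0) := by
  obtain ⟨R, hR, hsupp⟩ := hφ.exists_bound
  have hline : ∀ s : ℝ, Integrable fun t => P s * φ (t, s) := fun s =>
    ((hφ.1.continuous.comp (by fun_prop : Continuous fun t : ℝ => (t, s))).integrable_of_hasCompactSupport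
      (HasCompactSupport.of_support_subset_isCompact (isCompact_Icc (a := -R) (b := R))
        fun t ht => abs_le.1 (hsupp t s ht).1.le)).const_mul (P s)
  have hP' : Continuous (deriv P) := hP.continuous_deriv (by simp)
  have hI : Integrable (fun x : ℝ × ℝ => P x.2 * pd2 φ x + deriv P x.2 * φ x) := by
    refine Integrable.add ?_ ?_
    · exact ((hP.continuous.comp continuous_snd).mul
        (continuous_pd2 hφ.1)).integrable_of_hasCompactSupport (hasCompactSupport_pd2 hφ.2.1).mul_left
    · exact ((hP'.comp continuous_snd).mul
        hφ.1.continuous).integrable_of_hasCompactSupport hφ.2.1.mul_left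
  rw [strip, Measure.volume_eq_prod, setIntegral_prod _ (by
    rw [← Measure.volume_eq_prod]; exact hI.integrableOn), setIntegral_univ,
    ← integral_sub (hline 1) (hline 0)]
  congr 1; ext t
  have h1 : ∀ s, HasDerivAt (fun s => P s * φ (t, s)) (P s * pd2 φ (t, s) + deriv P s * φ (t, s)) s := by
    intro s
    have := (hP.differentiable (by simp) s).hasDerivAt.mul
      (hasDerivAt_pd2 (hφ.1.differentiable (by simp)) t s)
    convert! this using 1
    ring
  rw [← integral_Ioc_eq_integral_Ioo, ← intervalIntegral.integral_of_le zero_le_one]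
  refine intervalIntegral.integral_eq_sub_of_hasDerivAt (fun s _ => h1 s) ?_
  refine Continuous.intervalIntegrable ?_ _ _
  have e1 : Continuous fun s => pd2 φ (t, s) := (continuous_pd2 hφ.1).comp (by fun_prop)
  have e2 : Continuous fun s => φ (t, s) := hφ.1.continuous.comp (by fun_prop)
  exact (hP.continuous.mul e1).add (hP'.mul e2)

theorem integral_strip_mul_pd1 {P : ℝ → ℝ} (hP : Continuous P) {φ : ℝ × ℝ → ℝ}
    (hφ : IsTest univ φ) : ∫ x in strip, P x.2 * pd1 φ x = 0 := by
  have hI : Integrable (fun x : ℝ × ℝ => P x.2 * pd1 φ x) :=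
    ((hP.comp continuous_snd).mul
      (continuous_pd1 hφ.1)).integrable_of_hasCompactSupport (hasCompactSupport_pd1 hφ.2.1).mul_left
  obtain ⟨R, hR, hsupp⟩ := hφ.exists_bound
  have hI' : Integrable (fun x : ℝ × ℝ => P x.2 * pd1 φ x)
      ((volume : Measure ℝ).prod (volume.restrict (Ioo 0 1))) := by
    have := hI.integrableOn (s := strip)
    rwa [IntegrableOn, strip, Measure.volume_eq_prod, ← Measure.prod_restrict,
      Measure.restrict_univ] at this
  rw [strip, Measure.volume_eq_prod, ← Measure.prod_restrict, Measure.restrict_univ,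
    integral_prod_symm _ hI']
  refine integral_eq_zero_of_ae (Filter.Eventually.of_forall fun s => ?_)
  simp only [Pi.zero_apply]
  rw [integral_const_mul]
  have hc : HasCompactSupport fun t => φ (t, s) :=
    HasCompactSupport.of_support_subset_isCompact (isCompact_Icc (a := -R) (b := R))
      fun t ht => abs_le.1 (hsupp t s ht).1.le
  have hd : ∀ t, HasDerivAt (fun t => φ (t, s)) (pd1 φ (t, s)) t := fun t =>
    hasDerivAt_pd1 (hφ.1.differentiable (by simp)) t s
  have hd' : (fun t => pd1 φ (t, s)) = deriv fun t => φ (t, s) :=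
    funext fun t => (hd t).deriv.symm
  rw [integral_eq_zero_of_hasDerivAt_of_integrable hd, mul_zero]
  · refine ((continuous_pd1 hφ.1).comp (by fun_prop : Continuous fun t : ℝ =>
      (t, s))).integrable_of_hasCompactSupport ?_
    have := hc.deriv
    rwa [← hd'] at this
  · exact (hφ.1.continuous.comp (by fun_prop : Continuous fun t : ℝ =>
      (t, s))).integrable_of_hasCompactSupport hc

theorem IsTest.eq_zero_of_strip {φ : ℝ × ℝ → ℝ} (hφ : IsTest strip φ) (t : ℝ) :
    φ (t, 0) = 0 ∧ φ (t, 1) = 0 := by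
  constructor <;>
  · by_contra h
    have := (hφ.2.2 (subset_tsupport _ h)).2
    simp at this

theorem integral_strip_by_parts {P : ℝ → ℝ} (hP : ContDiff ℝ ∞ P) {φ : ℝ × ℝ → ℝ}
    (hφ : IsTest strip φ) :
    ∫ x in strip, P x.2 * pd2 φ x = -∫ x in strip, deriv P x.2 * φ x := by
  have h := integral_strip_green hP ⟨hφ.1, hφ.2.1, subset_univ _⟩
  simp only [hφ.eq_zero_of_strip, mul_zero, integral_zero, sub_zero] at h
  rw [integral_add] at h
  · linarith
  · exact (((hP.continuous.comp continuous_snd).mul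
      (continuous_pd2 hφ.1)).integrable_of_hasCompactSupport
        (hasCompactSupport_pd2 hφ.2.1).mul_left).integrableOn
  · exact ((((hP.continuous_deriv (by simp)).comp continuous_snd).mul
      hφ.1.continuous).integrable_of_hasCompactSupport hφ.2.1.mul_left).integrableOn

theorem memLp_comp_snd {P : ℝ → ℝ} (hP : Continuous P) (L : ℝ) :
    MemLp (fun x : ℝ × ℝ => P x.2) 2 (volume.restrict (Omega0 L)) := by
  have : IsFiniteMeasure (volume.restrict (Omega0 L)) :=
    isFiniteMeasure_restrict.2 (volume_Omega0_ne_top L)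
  obtain ⟨M, hM⟩ := (isCompact_Icc (a := (0 : ℝ)) (b := 1)).exists_bound_of_continuousOn
    hP.continuousOn
  refine MemLp.of_bound (hP.comp continuous_snd).aestronglyMeasurable M ?_
  exact (ae_restrict_iff' (isOpen_Omega0 L).measurableSet).2
    (Filter.Eventually.of_forall fun x hx => hM _ ⟨hx.2.1.le, hx.2.2.le⟩)

/-- A smooth function of `x₂` vanishing at `x₂ = 1`, as an element of `H11`. -/
noncomputable def H11.ofProfile (L : ℝ) {U : ℝ → ℝ} (hU : ContDiff ℝ ∞ U) (h1 : U 1 = 0) :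
    H11 L where
  toFun x := U x.2
  d1 _ := 0
  d2 x := deriv U x.2
  tr _ := U 0
  dtr _ := 0
  periodic _ _ := rfl
  periodic_d1 _ _ := rfl
  periodic_d2 _ _ := rfl
  periodic_tr _ := rfl
  periodic_dtr _ := rfl
  weak := by
    have hc : Continuous fun x : ℝ × ℝ => deriv U x.2 :=
      (hU.continuous_deriv (by simp)).comp continuous_snd
    refine ⟨(hU.continuous.comp continuous_snd).locallyIntegrable.locallyIntegrableOn _,
      locallyIntegrable_zero.locallyIntegrableOn _, hc.locallyIntegrable.locallyIntegrableOn _,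
      fun φ hφ => ?_, fun φ hφ => integral_strip_by_parts hU hφ⟩
    rw [integral_strip_mul_pd1 hU.continuous ⟨hφ.1, hφ.2.1, subset_univ _⟩]
    simp
  memLp := memLp_comp_snd hU.continuous L
  memLp_d1 := MemLp.zero
  memLp_d2 := memLp_comp_snd (hU.continuous_deriv (by simp)) L
  traces := by
    refine ⟨locallyIntegrable_const _, locallyIntegrable_zero, fun φ hφ => ?_⟩
    rw [integral_strip_green hU hφ, h1]
  memLp_tr :=
    haveI : IsFiniteMeasure (volume.restrict (Ioo 0 L)) :=
      isFiniteMeasure_restrict.2 measure_Ioo_lt_top.ne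
    memLp_const _
  memLp_dtr := MemLp.zero
  weak_tr ψ hψ hc := by
    have h := integral_eq_zero_of_hasDerivAt_of_integrable
      (fun t => (hψ.differentiable (by simp) t).hasDerivAt)
      ((hψ.continuous_deriv (by simp)).integrable_of_hasCompactSupport hc.deriv)
      (hψ.continuous.integrable_of_hasCompactSupport hc)
    rw [integral_const_mul, h]
    simp

/-! ### The explicit quadratic solution -/

theorem exists_profile (C : ℝ) {ε b : ℝ} (c : ℝ) (hε : 0 < ε) (hb : 0 < b) :
    ∃ U : ℝ → ℝ, ContDiff ℝ ∞ U ∧ U 1 = 0 ∧ (∀ s, deriv (deriv U) s = -C) ∧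
      U 0 = ε * b * deriv U 0 + ε ^ 2 / 2 * c * (-C) := by
  have hpos : 0 < 1 + ε * b := by positivity
  -- With `U'' = -C` and `U(1) = 0` the only free parameter is the linear coefficient; the condition
  -- at `0` is then a linear equation with factor `1 + εb`, nonzero because `b > 0`.
  set a := (C / 2 + ε ^ 2 / 2 * c * C) / (1 + ε * b) with ha
  have hae : a * (1 + ε * b) = C / 2 + ε ^ 2 / 2 * c * C := div_mul_cancel₀ _ hpos.ne'
  set U : ℝ → ℝ := fun s => -(C / 2) * s ^ 2 + a * s + (C / 2 - a) with hU
  have hd : ∀ s, HasDerivAt U (-C * s + a) s := fun s => by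
    have h1 := (((hasDerivAt_id s).pow 2).const_mul (-(C / 2))).add ((hasDerivAt_id s).const_mul a)
    have h2 := h1.add_const (C / 2 - a)
    convert! h2 using 1
    simp; ring
  have hd' : deriv U = fun s => -C * s + a := funext fun s => (hd s).deriv
  refine ⟨U, by fun_prop, by simp [hU], fun s => ?_, ?_⟩
  · rw [hd']
    simp
  · rw [hd']
    simp only [hU]
    linear_combination -hae

theorem solvesPoisson_ofProfile {L C : ℝ} {U : ℝ → ℝ} (hU : ContDiff ℝ ∞ U) (h1 : U 1 = 0)
    (h2 : ∀ s, deriv (deriv U) s = -C) : SolvesPoisson C (H11.ofProfile L hU h1) := by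
  intro φ hφ
  have hU' : ContDiff ℝ ∞ (deriv U) := (contDiff_infty_iff_deriv.1 hU).2
  simp only [H11.ofProfile, zero_mul, zero_add]
  rw [integral_strip_by_parts hU' hφ]
  simp only [h2, neg_mul, integral_neg, neg_neg, integral_const_mul]

theorem solvesWentzell_ofProfile {L C ε b c : ℝ} {U : ℝ → ℝ} (hU : ContDiff ℝ ∞ U)
    (h1 : U 1 = 0) (h2 : ∀ s, deriv (deriv U) s = -C)
    (h0 : U 0 = ε * b * deriv U 0 + ε ^ 2 / 2 * c * (-C)) :
    SolvesWentzell ε b c (H11.ofProfile L hU h1) := by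
  intro φ _ _
  set I := ∫ s in (0 : ℝ)..L, φ s
  have hdiff : Differentiable ℝ U := hU.differentiable (by simp)
  have hdiff' : Differentiable ℝ (deriv U) :=
    ((contDiff_infty_iff_deriv.1 hU).2).differentiable (by simp)
  have hd : deriv (fun t => U t * I) = fun t => deriv U t * I :=
    funext fun t => ((hdiff t).hasDerivAt.mul_const I).deriv
  refine ⟨fun t => U t * I, contDiff_infty.1 (hU.mul contDiff_const) 2,
    Filter.Eventually.of_forall fun t => ?_, ?_⟩
  · simp only [H11.ofProfile, intervalIntegral.integral_const_mul, I]
  · rw [iteratedDeriv_succ, iteratedDeriv_one, hd, ((hdiff' 0).hasDerivAt.mul_const I).deriv, h2]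
    linear_combination I * h0

/-- The Gauss-Green formula in `x₂` against smooth functions of `x₂`. -/
theorem H11.integral_green_snd {L : ℝ} (u : H11 L) (hL : 0 < L) {b : ℝ → ℝ}
    (hb : ContDiff ℝ ∞ b) :
    (∫ x in Omega0 L, u.toFun x * deriv b x.2) + ∫ x in Omega0 L, u.d2 x * b x.2 =
      -(b 0 * ∫ t in Ioo 0 L, u.tr t) := by
  -- Inner radius `1` about `1/2` makes the bump equal to `1` on a neighbourhood of `[0, 1]`, so it
  -- affects neither the integrals nor the value at `0`.
  let κ : ContDiffBump (1 / 2 : ℝ) := ⟨1, 2, one_pos, one_lt_two⟩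
  have hκ1 : ∀ s ∈ Ioo (-1 / 2 : ℝ) (3 / 2), κ s * b s = b s := fun s hs => by
    rw [κ.one_of_mem_closedBall, one_mul]
    rw [Metric.mem_closedBall, Real.dist_eq, abs_le]
    change -1 ≤ s - 1 / 2 ∧ s - 1 / 2 ≤ 1
    constructor <;> linarith [hs.1, hs.2]
  have hκ2 : ∀ s ∈ Ioo (0 : ℝ) 1, deriv (fun s => κ s * b s) s = deriv b s := fun s hs => by
    refine Filter.EventuallyEq.deriv_eq ?_
    filter_upwards [Ioo_mem_nhds (show -1 / 2 < s by linarith [hs.1])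
      (show s < 3 / 2 by linarith [hs.2])] with r hr using hκ1 r hr
  have h := u.integral_green hL (a := fun _ => 1) contDiff_const (fun _ => rfl)
    (b := fun s => κ s * b s) (κ.contDiff.mul hb) κ.hasCompactSupport.mul_right
  have hΩ := (isOpen_Omega0 L).measurableSet
  have e1 : ∫ x in Omega0 L, u.toFun x * (1 * deriv (fun s => κ s * b s) x.2) =
      ∫ x in Omega0 L, u.toFun x * deriv b x.2 :=
    setIntegral_congr_fun hΩ fun x hx => by simp only [hκ2 x.2 hx.2, one_mul]
  have e2 : ∫ x in Omega0 L, u.d2 x * (1 * (κ x.2 * b x.2)) = ∫ x in Omega0 L, u.d2 x * b x.2 :=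
    setIntegral_congr_fun hΩ fun x hx => by
      simp only [hκ1 x.2 ⟨by linarith [hx.2.1], by linarith [hx.2.2]⟩, one_mul]
  rw [e1, e2, hκ1 0 (by constructor <;> norm_num)] at h
  simpa using h

/-- Since `U'' = -C`, the Green formula against `U'` turns `∫ U' ∂₂v` into `C∫v` minus `U'(0)` times
the integral of the trace of `v`. The boundary condition divided by `εb` supplies exactly the
remaining trace terms. -/
theorem isVariationalSolution_ofProfile {L C ε b c : ℝ} (hL : 0 < L) (hε : 0 < ε) (hb : 0 < b)
    {U : ℝ → ℝ} (hU : ContDiff ℝ ∞ U)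
    (h1 : U 1 = 0) (h2 : ∀ s, deriv (deriv U) s = -C)
    (h0 : U 0 = ε * b * deriv U 0 + ε ^ 2 / 2 * c * (-C)) :
    IsVariationalSolution C ε b c (H11.ofProfile L hU h1) := by
  intro v
  have h := v.integral_green_snd hL (contDiff_infty_iff_deriv.1 hU).2
  simp only [h2, mul_neg, integral_neg, integral_mul_const] at h
  simp only [formA, formL, H11.ofProfile, zero_mul, zero_add, integral_const_mul, integral_zero,
    mul_zero, sub_zero]
  have e : ∫ x in Omega0 L, deriv U x.2 * v.d2 x = ∫ x in Omega0 L, v.d2 x * deriv U x.2 := by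
    simp only [mul_comm]
  rw [e]
  have e2 : 1 / (ε * b) * U 0 = deriv U 0 - ε * (c / (2 * b)) * C := by
    rw [h0]
    field_simp
    ring
  rw [← mul_assoc, e2]
  linear_combination h

/-! ### Uniqueness for the variational formulation -/

/-- A compact set meets only finitely many of the half-open period cells, and on each of them
integrability is transported by translation. -/
theorem integrableOn_strip_inter {L : ℝ} (hL : 0 < L) {v : ℝ × ℝ → ℝ} (hp : PeriodicX1 L v)
    (hv : IntegrableOn v (Omega0 L)) {K : Set (ℝ × ℝ)} (hK : IsCompact K) :
    IntegrableOn v (strip ∩ K) := by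
  have hpz : ∀ (k : ℤ) (t s : ℝ), v (t + k * L, s) = v (t, s) := fun k t s => by
    have : Function.Periodic (fun t => v (t, s)) L := fun t => hp t s
    exact this.int_mul k t
  have h0 : IntegrableOn v (Ico 0 L ×ˢ Ioo 0 1) := by
    refine hv.congr_set_ae ?_
    rw [Measure.volume_eq_prod]
    exact Measure.set_prod_ae_eq Ioo_ae_eq_Ico.symm (Filter.EventuallyEq.refl _ _)
  have hk : ∀ k : ℤ, IntegrableOn v (Ico (k * L) (k * L + L) ×ˢ Ioo 0 1) := by
    intro k
    have h1 : IntegrableOn (v ∘ fun x : ℝ × ℝ => (x.1 + k * L, x.2)) (Ico 0 L ×ˢ Ioo 0 1) :=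
      h0.congr_fun (fun x _ => (hpz k x.1 x.2).symm) (measurableSet_Ico.prod measurableSet_Ioo)
    have h2 := ((measurePreserving_shift (k * L)).integrableOn_image
      (measurableEmbedding_shift (k * L))).2 h1
    have := prodMap_image_prod (fun x : ℝ => x + k * L) (fun x : ℝ => x) (Ico 0 L) (Ioo 0 1)
    rw [image_add_const_Ico, zero_add, image_id', add_comm L] at this
    rw [← this]
    exact h2
  obtain ⟨R, hR⟩ := hK.isBounded.exists_norm_le
  refine ((integrableOn_finite_biUnion (finite_Icc ⌊-R / L⌋ ⌊R / L⌋)).2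
    fun k _ => hk k).mono_set ?_
  rintro x ⟨hx, hxK⟩
  have hxR := hR x hxK
  rw [Prod.norm_def, max_le_iff] at hxR
  have hx1 := abs_le.1 hxR.1
  refine mem_biUnion (x := ⌊x.1 / L⌋) ⟨?_, ?_⟩ ⟨⟨?_, ?_⟩, hx.2⟩
  · exact Int.floor_le_floor (by gcongr; exact hx1.1)
  · exact Int.floor_le_floor (by gcongr; exact hx1.2)
  · rw [← le_div_iff₀ hL]
    exact Int.floor_le _
  · rw [← add_one_mul, ← div_lt_iff₀ hL]
    exact Int.lt_floor_add_one _

theorem strip_subset_above : strip ⊆ above fun _ => 0 := fun _ hx => hx.2.1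

/-- The trace on `x₂ = 1` is zero, so extension by zero creates no jump there. The extension is a
function on the half-plane, to which `HasGraphTrace.ae_eq_primitive` applies. -/
theorem H11.hasGraphTrace {L : ℝ} (hL : 0 < L) (u : H11 L) :
    HasGraphTrace (fun _ => 0) (strip.indicator u.toFun) (strip.indicator u.d2) u.tr := by
  have hs := isOpen_strip.measurableSet
  have hi : ∀ v : ℝ × ℝ → ℝ, PeriodicX1 L v → IntegrableOn v (Omega0 L) → ∀ K, IsCompact K →
      IntegrableOn (strip.indicator v) ((above fun _ => 0) ∩ K) := by
    intro v hp hv K hK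
    rw [IntegrableOn, integrable_indicator_iff hs, IntegrableOn, Measure.restrict_restrict hs]
    exact (integrableOn_strip_inter hL hp hv hK).mono_set
      (inter_subset_inter_right _ inter_subset_right)
  refine ⟨u.traces.locInt0, hi _ u.periodic u.integrableOn_toFun,
    hi _ u.periodic_d2 u.integrableOn_d2, fun φ hφ => ?_⟩
  have h := u.traces.green φ hφ
  simp only [zero_mul, integral_zero, zero_sub] at h
  rw [← h, ← inter_eq_right.2 strip_subset_above, ← setIntegral_indicator hs,
    inter_eq_right.2 strip_subset_above]
  congr 1; ext x
  by_cases hx : x ∈ strip <;> simp [hx]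

theorem H11.tr_eq {L : ℝ} (hL : 0 < L) (u : H11 L) :
    ∀ᵐ t : ℝ, u.tr t = -∫ r in (0 : ℝ)..1, u.d2 (t, r) := by
  have h := (u.hasGraphTrace hL).ae_eq_primitive continuous_const (fun _ => le_rfl)
  rw [Measure.volume_eq_prod] at h
  filter_upwards [Measure.ae_ae_of_ae_prod h] with t ht
  -- At a height beyond `1` the extended function is zero, so the primitive formula expresses the
  -- trace through `d2` alone. The formula holds for almost every `s`, hence for some `s` in `(1,
  -- 2)`.
  obtain ⟨s, hs1, hs⟩ : ∃ s : ℝ, s ∈ Ioo 1 2 ∧ ((t, s) ∈ (above fun _ => 0) →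
      strip.indicator u.toFun (t, s) = u.tr t + ∫ r in (0 : ℝ)..s, strip.indicator u.d2 (t, r)) := by
    by_contra hcon
    push Not at hcon
    have : volume (Ioo (1 : ℝ) 2) = 0 := by
      rw [measure_eq_zero_iff_ae_notMem]
      filter_upwards [ht] with s hs hs1
      obtain ⟨ha, hb⟩ := hcon s hs1
      exact hb (hs ha)
    rw [Real.volume_Ioo, ENNReal.ofReal_eq_zero] at this
    norm_num at this
  have e := hs (show (0 : ℝ) < s by linarith [hs1.1])
  rw [indicator_of_notMem (fun hx : (t, s) ∈ strip => by
    have := hx.2.2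
    simp only at this
    linarith [hs1.1])] at e
  have e2 : ∫ r in (0 : ℝ)..s, strip.indicator u.d2 (t, r) = ∫ r in (0 : ℝ)..1, u.d2 (t, r) := by
    rw [intervalIntegral.integral_of_le (by linarith [hs1.1]),
      intervalIntegral.integral_of_le zero_le_one, integral_Ioc_eq_integral_Ioo (y := (1 : ℝ)),
      ← inter_eq_right.2 (show Ioo (0 : ℝ) 1 ⊆ Ioc 0 s from
        fun r hr => ⟨hr.1, by linarith [hr.2, hs1.1]⟩), ← setIntegral_indicator measurableSet_Ioo]
    congr 1; ext r
    simp [indicator, strip]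
  rw [e2] at e
  linarith

theorem H11.same_of_d2_eq {L : ℝ} (hL : 0 < L) {u w : H11 L}
    (h : w.d2 =ᵐ[volume.restrict (Omega0 L)] u.d2) : w.Same u := by
  have hΩ := (isOpen_Omega0 L).measurableSet
  rw [Filter.EventuallyEq, ae_restrict_iff' hΩ, Measure.volume_eq_prod] at h
  have hu := (u.hasGraphTrace hL).ae_eq_primitive continuous_const (fun _ => le_rfl)
  have hw := (w.hasGraphTrace hL).ae_eq_primitive continuous_const (fun _ => le_rfl)
  rw [H11.Same, Filter.EventuallyEq, ae_restrict_iff' hΩ]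
  filter_upwards [hu, hw, ae_fst (Measure.ae_ae_of_ae_prod h), ae_fst (u.tr_eq hL),
    ae_fst (w.tr_eq hL)] with x hxu hxw hxd htu htw hx
  have hstrip := Omega0_subset_strip L hx
  have e1 := hxu (strip_subset_above hstrip)
  have e2 := hxw (strip_subset_above hstrip)
  rw [indicator_of_mem hstrip] at e1 e2
  rw [e1, e2, htu, htw]
  have h01 : ∫ r in (0 : ℝ)..1, w.d2 (x.1, r) = ∫ r in (0 : ℝ)..1, u.d2 (x.1, r) := by
    refine intervalIntegral.integral_congr_ae ?_
    filter_upwards [hxd, Measure.ae_ne volume (1 : ℝ)] with r hr hr1 hrI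
    rw [uIoc_of_le zero_le_one] at hrI
    exact hr ⟨hx.1, hrI.1, lt_of_le_of_ne hrI.2 hr1⟩
  have h0s : ∫ r in (0 : ℝ)..x.2, strip.indicator w.d2 (x.1, r) =
      ∫ r in (0 : ℝ)..x.2, strip.indicator u.d2 (x.1, r) := by
    refine intervalIntegral.integral_congr_ae ?_
    filter_upwards [hxd] with r hr hrI
    rw [uIoc_of_le hx.2.1.le] at hrI
    have : (x.1, r) ∈ Omega0 L := ⟨hx.1, hrI.1, lt_of_le_of_lt hrI.2 hx.2.2⟩
    rw [indicator_of_mem (Omega0_subset_strip L this), indicator_of_mem (Omega0_subset_strip L this)]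
    exact hr this
  rw [h01, h0s]

theorem integral_sub_sq {α : Type*} [MeasurableSpace α] {μ : Measure α} {p q : α → ℝ}
    (hp : MemLp p 2 μ) (hq : MemLp q 2 μ) :
    ∫ x, (p x - q x) ^ 2 ∂μ = (∫ x, p x * p x ∂μ) - 2 * (∫ x, q x * p x ∂μ) + ∫ x, q x * q x ∂μ := by
  have i1 : Integrable (fun x => p x * p x) μ := hp.integrable_mul hp
  have i2 : Integrable (fun x => q x * p x) μ := hq.integrable_mul hp
  have i3 : Integrable (fun x => q x * q x) μ := hq.integrable_mul hq
  rw [← integral_const_mul, ← integral_sub i1 (i2.const_mul 2), ← integral_add _ i3]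
  · congr 1; ext x; ring
  · exact i1.sub (i2.const_mul 2)

/-- Testing both equations with both solutions and using symmetry gives `a(w, w) - 2a(u, w) + a(u,
u) = 0`, the form evaluated on the difference, without building the difference as an element of
`H11`. With `b > 0` and `c ≤ 0` every term is nonnegative, so `∂₂(w - u) = 0`, which is enough by
`H11.same_of_d2_eq`. -/
theorem IsVariationalSolution.same {L C ε b c : ℝ} (hL : 0 < L) (hε : 0 < ε) (hb : 0 < b)
    (hc : c ≤ 0) {u w : H11 L} (hu : IsVariationalSolution C ε b c u)
    (hw : IsVariationalSolution C ε b c w) : w.Same u := by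
  have hT := integral_sub_sq w.memLp_tr u.memLp_tr
  have hS := integral_sub_sq w.memLp_dtr u.memLp_dtr
  have h1 := integral_sub_sq w.memLp_d1 u.memLp_d1
  have h2 := integral_sub_sq w.memLp_d2 u.memLp_d2
  have split : ∀ p q : H11 L, ∫ x in Omega0 L, (p.d1 x * q.d1 x + p.d2 x * q.d2 x) =
      (∫ x in Omega0 L, p.d1 x * q.d1 x) + ∫ x in Omega0 L, p.d2 x * q.d2 x := fun p q =>
    integral_add (p.memLp_d1.integrable_mul q.memLp_d1) (p.memLp_d2.integrable_mul q.memLp_d2)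
  have huw := (hu w).trans (hw w).symm
  have huu := (hu u).trans (hw u).symm
  have symm : formA ε b c w u = formA ε b c u w := by
    simp only [formA, mul_comm]
  rw [symm] at huu
  simp only [formA, split] at huw huu
  set T := ∫ t in Ioo 0 L, (w.tr t - u.tr t) ^ 2
  set S := ∫ t in Ioo 0 L, (w.dtr t - u.dtr t) ^ 2
  set X1 := ∫ x in Omega0 L, (w.d1 x - u.d1 x) ^ 2
  set X2 := ∫ x in Omega0 L, (w.d2 x - u.d2 x) ^ 2 with hX2
  have hT0 : 0 ≤ T := integral_nonneg fun _ => sq_nonneg _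
  have hS0 : 0 ≤ S := integral_nonneg fun _ => sq_nonneg _
  have hX10 : 0 ≤ X1 := integral_nonneg fun _ => sq_nonneg _
  have hX20 : 0 ≤ X2 := integral_nonneg fun _ => sq_nonneg _
  have key : 1 / (ε * b) * T + X1 + X2 + -(ε * (c / (2 * b))) * S = 0 := by
    rw [hT, hS, h1, h2]
    linear_combination huu - huw
  have k1 : 0 ≤ 1 / (ε * b) * T := by positivity
  have k2 : 0 ≤ -(ε * (c / (2 * b))) * S := by
    refine mul_nonneg ?_ hS0
    rw [neg_nonneg]
    exact mul_nonpos_of_nonneg_of_nonpos hε.le (div_nonpos_of_nonpos_of_nonneg hc (by linarith))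
  have hX : X2 = 0 := by linarith
  refine H11.same_of_d2_eq hL ?_
  have hi : Integrable (fun x => (w.d2 x - u.d2 x) ^ 2) (volume.restrict (Omega0 L)) :=
    (w.memLp_d2.sub u.memLp_d2).integrable_sq
  filter_upwards [(integral_eq_zero_iff_of_nonneg (fun _ => sq_nonneg _) hi).1 hX] with x hx
  have : w.d2 x - u.d2 x = 0 := by simpa using hx
  linarith

/-! ### Uniqueness for the distributional formulation -/

/-- Energy argument: multiplying the equation by `n` and integrating gives `∫ (n'² + k n²) = -n(0)
n'(0)`. The boundary condition makes `εb n(0) n'(0)` equal to `n(0)²(1 - ε² c k / 2)`, nonnegative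
precisely thanks to the sign of `c`. So `n' = 0`, and `n(1) = 0` finishes. -/
theorem eq_zero_of_mode {k ε b c : ℝ} (hk : 0 ≤ k) (hε : 0 < ε) (hb : 0 < b) (hc : c ≤ 0)
    {n : ℝ → ℝ} (hn : ContDiff ℝ 2 n) (hode : ∀ t ∈ Icc (0 : ℝ) 1, deriv (deriv n) t = k * n t)
    (h1 : n 1 = 0) (h0 : n 0 = ε * b * deriv n 0 + ε ^ 2 / 2 * c * deriv (deriv n) 0) :
    ∀ t ∈ Icc (0 : ℝ) 1, n t = 0 := by
  have hn1 : ContDiff ℝ 1 (deriv n) := ((contDiff_succ_iff_deriv (n := 1)).1 hn).2.2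
  have hd : ∀ t, HasDerivAt n (deriv n t) t := fun t =>
    (hn.differentiable (by norm_num) t).hasDerivAt
  have hd' : ∀ t, HasDerivAt (deriv n) (deriv (deriv n) t) t := fun t =>
    (hn1.differentiable (by norm_num) t).hasDerivAt
  have hc0 := hn.continuous
  have hc1 := hn1.continuous
  have hc2 : Continuous (deriv (deriv n)) := hn1.continuous_deriv le_rfl
  have henergy : ∫ t in (0 : ℝ)..1, (deriv n t * deriv n t + n t * deriv (deriv n) t) =
      n 1 * deriv n 1 - n 0 * deriv n 0 :=
    intervalIntegral.integral_eq_sub_of_hasDerivAt (fun t _ => (hd t).mul (hd' t))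
      (by apply Continuous.intervalIntegrable; fun_prop)
  have hcong : ∫ t in (0 : ℝ)..1, (deriv n t * deriv n t + n t * deriv (deriv n) t) =
      ∫ t in (0 : ℝ)..1, (deriv n t ^ 2 + k * n t ^ 2) := by
    refine intervalIntegral.integral_congr fun t ht => ?_
    rw [uIcc_of_le zero_le_one] at ht
    simp only [hode t ht]
    ring
  -- The equation holds up to the endpoint, so the second derivative in the boundary condition
  -- becomes `k n(0)`, which leaves a Robin condition.
  rw [hode 0 (by simp)] at h0
  have hle : ∫ t in (0 : ℝ)..1, (deriv n t ^ 2 + k * n t ^ 2) ≤ 0 := by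
    rw [← hcong, henergy, h1]
    have e : (ε * b) * (n 0 * deriv n 0) = n 0 ^ 2 * (1 + ε ^ 2 / 2 * (-c) * k) := by
      linear_combination (-n 0) * h0
    have hpos : 0 ≤ n 0 ^ 2 * (1 + ε ^ 2 / 2 * (-c) * k) := by
      have : 0 ≤ -c := by linarith
      positivity
    have : 0 ≤ n 0 * deriv n 0 := by
      rw [← e] at hpos
      exact nonneg_of_mul_nonneg_right hpos (by positivity)
    linarith
  have hz : ∀ t ∈ Icc (0 : ℝ) 1, deriv n t = 0 := by
    intro t ht
    by_contra hne
    refine absurd hle (not_le.2 ?_)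
    refine intervalIntegral.integral_pos zero_lt_one (by fun_prop)
      (fun s _ => by positivity) ⟨t, ht, by positivity⟩
  intro t ht
  have := intervalIntegral.integral_eq_sub_of_hasDerivAt (a := t) (b := 1) (fun s _ => hd s)
    (hc1.intervalIntegrable _ _)
  rw [intervalIntegral.integral_congr (g := fun _ => 0) fun s hs => by
    rw [uIcc_of_le ht.2] at hs
    exact hz s ⟨ht.1.trans hs.1, hs.2⟩, intervalIntegral.integral_zero, h1] at this
  linarith

/-! ### Pairings on horizontal lines as functions of `x₂` -/

theorem integral_Omega0 {L : ℝ} {F : ℝ × ℝ → ℝ} (hF : IntegrableOn F (Omega0 L)) :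
    ∫ x in Omega0 L, F x = ∫ t in Ioo (0 : ℝ) 1, ∫ s in Ioo 0 L, F (s, t) := by
  rw [IntegrableOn, Omega0, Measure.volume_eq_prod, ← Measure.prod_restrict] at hF
  rw [Omega0, Measure.volume_eq_prod, ← Measure.prod_restrict, integral_prod_symm _ hF]

theorem integrableOn_mul_prod {L : ℝ} {P : ℝ × ℝ → ℝ} (hP : IntegrableOn P (Omega0 L))
    {a q : ℝ → ℝ} (ha : Continuous a) (hq : Continuous q) :
    IntegrableOn (fun x => P x * (a x.1 * q x.2)) (Omega0 L) := by
  have hK : IsCompact (Icc 0 L ×ˢ Icc (0 : ℝ) 1) := isCompact_Icc.prod isCompact_Icc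
  have hc : Continuous fun x : ℝ × ℝ => a x.1 * q x.2 := by fun_prop
  obtain ⟨M, hM⟩ := hK.exists_bound_of_continuousOn hc.continuousOn
  refine Integrable.mul_bdd (c := M) hP hc.aestronglyMeasurable ?_
  exact (ae_restrict_iff' (isOpen_Omega0 L).measurableSet).2 (Filter.Eventually.of_forall
    fun x hx => hM _ ⟨Ioo_subset_Icc_self hx.1, Ioo_subset_Icc_self hx.2⟩)

theorem integral_Omega0_mul_prod {L : ℝ} {P : ℝ × ℝ → ℝ} (hP : IntegrableOn P (Omega0 L))
    {a q : ℝ → ℝ} (ha : Continuous a) (hq : Continuous q) :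
    ∫ x in Omega0 L, P x * (a x.1 * q x.2) =
      ∫ t in Ioo (0 : ℝ) 1, (∫ s in Ioo 0 L, P (s, t) * a s) * q t := by
  rw [integral_Omega0 (integrableOn_mul_prod hP ha hq)]
  congr 1; ext t
  rw [← integral_mul_const]
  congr 1; ext s
  ring

theorem integrableOn_pairing {L : ℝ} {P : ℝ × ℝ → ℝ} (hP : IntegrableOn P (Omega0 L))
    {a : ℝ → ℝ} (ha : Continuous a) :
    IntegrableOn (fun t => ∫ s in Ioo 0 L, P (s, t) * a s) (Ioo 0 1) := by
  have h := integrableOn_mul_prod hP ha (q := fun _ => 1) continuous_const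
  rw [IntegrableOn, Omega0, Measure.volume_eq_prod, ← Measure.prod_restrict] at h
  have := h.integral_prod_right
  simp only [mul_one] at this
  exact this

theorem ae_integrableOn_section {L : ℝ} {P : ℝ × ℝ → ℝ} (hP : IntegrableOn P (Omega0 L)) :
    ∀ᵐ t ∂(volume.restrict (Ioo (0 : ℝ) 1)), IntegrableOn (fun s => P (s, t)) (Ioo 0 L) := by
  rw [IntegrableOn, Omega0, Measure.volume_eq_prod, ← Measure.prod_restrict] at hP
  exact hP.prod_left_ae

theorem ae_eq_of_forall_test {p q : ℝ → ℝ} (hp : IntegrableOn p (Ioo 0 1))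
    (hq : IntegrableOn q (Ioo 0 1))
    (h : ∀ b : ℝ → ℝ, ContDiff ℝ ∞ b → HasCompactSupport b → tsupport b ⊆ Ioo 0 1 →
      ∫ t in Ioo (0 : ℝ) 1, p t * b t = ∫ t in Ioo (0 : ℝ) 1, q t * b t) :
    ∀ᵐ t : ℝ, t ∈ Ioo (0 : ℝ) 1 → p t = q t := by
  have := isOpen_Ioo.ae_eq_zero_of_integral_contDiff_smul_eq_zero (f := fun t => p t - q t)
    (μ := volume) (U := Ioo (0 : ℝ) 1) (hp.sub hq).locallyIntegrableOn fun b hb hbc hbI => ?_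
  · filter_upwards [this] with t ht htI
    linarith [ht htI]
  · obtain ⟨M, hM⟩ := hbc.exists_bound_of_continuous hb.continuous
    have i1 : IntegrableOn (fun t => p t * b t) (Ioo 0 1) :=
      Integrable.mul_bdd hp hb.continuous.aestronglyMeasurable (Filter.Eventually.of_forall hM)
    have i2 : IntegrableOn (fun t => q t * b t) (Ioo 0 1) :=
      Integrable.mul_bdd hq hb.continuous.aestronglyMeasurable (Filter.Eventually.of_forall hM)
    have e := h b hb hbc hbI
    rw [← sub_eq_zero, ← integral_sub i1 i2, setIntegral_eq_integral_of_forall_compl_eq_zero] at e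
    · rw [← e]
      congr 1; ext t
      rw [smul_eq_mul]; ring
    · intro t ht
      rw [image_eq_zero_of_notMem_tsupport fun h => ht (hbI h)]
      ring

theorem eqOn_Icc_of_ae_eq {p q : ℝ → ℝ} (hp : Continuous p) (hq : Continuous q)
    (h : ∀ᵐ t : ℝ, t ∈ Ioo (0 : ℝ) 1 → p t = q t) : EqOn p q (Icc 0 1) := by
  have h1 : EqOn p q (Ioo 0 1) :=
    Measure.eqOn_open_of_ae_eq ((ae_restrict_iff' measurableSet_Ioo).2 h) isOpen_Ioo
      hp.continuousOn hq.continuousOn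
  rw [← closure_Ioo zero_ne_one]
  exact h1.closure hp hq

theorem integral_Ioo_by_parts {p b : ℝ → ℝ} (hp : ContDiff ℝ 1 p) (hb : ContDiff ℝ ∞ b) :
    (∫ t in Ioo (0 : ℝ) 1, p t * deriv b t) =
      p 1 * b 1 - p 0 * b 0 - ∫ t in Ioo (0 : ℝ) 1, deriv p t * b t := by
  simp only [← integral_Ioc_eq_integral_Ioo, ← intervalIntegral.integral_of_le zero_le_one]
  exact intervalIntegral.integral_mul_deriv_eq_deriv_mul
    (fun t _ => (hp.differentiable (by norm_num) t).hasDerivAt)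
    (fun t _ => (hb.differentiable (by simp) t).hasDerivAt)
    ((hp.continuous_deriv le_rfl).intervalIntegrable _ _)
    ((hb.continuous_deriv (by simp)).intervalIntegrable _ _)

theorem _root_.Continuous.integrableOn_Ioo_zero_one {p : ℝ → ℝ} (hp : Continuous p) :
    IntegrableOn p (Ioo 0 1) :=
  (hp.integrableOn_Icc (a := 0) (b := 1)).mono_set Ioo_subset_Icc_self

/-- The pairing of a solution with an eigenfunction of the Laplacian on the circle. -/
theorem IsSolution.pairing_eq {L C ε b c : ℝ} (hL : 0 < L) (hε : 0 < ε) (hb : 0 < b) (hc : c ≤ 0)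
    {U : ℝ → ℝ} (hU : ContDiff ℝ ∞ U) (hU1 : U 1 = 0) (hU2 : ∀ s, deriv (deriv U) s = -C)
    (hU0 : U 0 = ε * b * deriv U 0 + ε ^ 2 / 2 * c * (-C)) {w : H11 L}
    (hw : IsSolution C ε b c w) {a : ℝ → ℝ} (ha : ContDiff ℝ ∞ a) (hp : Function.Periodic a L)
    {k : ℝ} (hk : 0 ≤ k) (hak : ∀ s, deriv (deriv a) s = -k * a s) :
    ∀ᵐ t ∂(volume.restrict (Ioo (0 : ℝ) 1)),
      ∫ s in Ioo 0 L, w.toFun (s, t) * a s = U t * ∫ s in Ioo 0 L, a s := by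
  have ha' : ContDiff ℝ ∞ (deriv a) := (contDiff_infty_iff_deriv.1 ha).2
  have hU' : ContDiff ℝ ∞ (deriv U) := (contDiff_infty_iff_deriv.1 hU).2
  have hp' : Function.Periodic (deriv a) L := fun s => by
    rw [← deriv_comp_add_const]
    exact congrFun (congrArg deriv (funext hp)) s
  set I := ∫ s in Ioo 0 L, a s with hI
  -- The integral of `a''` over a period vanishes: either `k = 0` or `a` has mean zero. Because of
  -- this `U·I` satisfies the same ODE as the pairing `m`, although `U` does not depend on the mode.
  have hkI : k * I = 0 := by
    have h1 : ∫ s in (0 : ℝ)..L, deriv (deriv a) s = 0 := by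
      rw [intervalIntegral.integral_eq_sub_of_hasDerivAt
        (fun s _ => (ha'.differentiable (by simp) s).hasDerivAt)
        ((ha'.continuous_deriv (by simp)).intervalIntegrable _ _)]
      have := hp' 0
      rw [zero_add] at this
      rw [this, sub_self]
    simp only [hak, intervalIntegral.integral_const_mul] at h1
    rw [intervalIntegral.integral_of_le hL.le, integral_Ioc_eq_integral_Ioo] at h1
    linarith
  clear_value I
  obtain ⟨m, hm, hma, hm0⟩ := hw.2 a ha hp
  have hma' : ∀ᵐ t ∂(volume.restrict (Ioo (0 : ℝ) 1)),
      ∫ s in Ioo 0 L, w.toFun (s, t) * a s = m t := by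
    filter_upwards [hma] with t ht
    rw [← ht, intervalIntegral.integral_of_le hL.le, integral_Ioc_eq_integral_Ioo]
  rw [iteratedDeriv_succ, iteratedDeriv_one] at hm0
  have hm1 : ContDiff ℝ 1 (deriv m) := ((contDiff_succ_iff_deriv (n := 1)).1 hm).2.2
  have hm2 : Continuous (deriv (deriv m)) := hm1.continuous_deriv le_rfl
  have hmC : ContDiff ℝ 1 m := hm.of_le (by norm_num)
  set D : ℝ → ℝ := fun t => ∫ s in Ioo 0 L, w.d2 (s, t) * a s with hD
  have hDi : IntegrableOn D (Ioo 0 1) := integrableOn_pairing w.integrableOn_d2 ha.continuous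
  have pair_w : ∀ q : ℝ → ℝ, Continuous q → ∫ x in Omega0 L, w.toFun x * (a x.1 * q x.2) =
      ∫ t in Ioo (0 : ℝ) 1, m t * q t := by
    intro q hq
    rw [integral_Omega0_mul_prod w.integrableOn_toFun ha.continuous hq]
    refine integral_congr_ae ?_
    filter_upwards [hma'] with t ht
    rw [ht]
  have pair_d : ∀ q : ℝ → ℝ, Continuous q → ∫ x in Omega0 L, w.d2 x * (a x.1 * q x.2) =
      ∫ t in Ioo (0 : ℝ) 1, D t * q t := fun q hq =>
    integral_Omega0_mul_prod w.integrableOn_d2 ha.continuous hq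
  set c0 := ∫ t in Ioo 0 L, w.tr t * a t
  -- Test functions supported inside `(0, 1)` will identify `D` with `m'`; one that is nonzero at
  -- `1` will then give `m(1) = 0`.
  have hG : ∀ b : ℝ → ℝ, ContDiff ℝ ∞ b → HasCompactSupport b →
      m 1 * b 1 - m 0 * b 0 - (∫ t in Ioo (0 : ℝ) 1, deriv m t * b t) +
        ∫ t in Ioo (0 : ℝ) 1, D t * b t = -(b 0 * c0) := by
    intro b hb hbc
    have h := w.integral_green hL ha hp hb hbc
    rwa [pair_w _ (hb.continuous_deriv (by simp)), pair_d _ hb.continuous,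
      integral_Ioo_by_parts hmC hb] at h
  have hends : ∀ {b : ℝ → ℝ}, tsupport b ⊆ Ioo 0 1 → b 0 = 0 ∧ b 1 = 0 := by
    intro b hbI
    constructor <;>
    · refine image_eq_zero_of_notMem_tsupport fun h => ?_
      have := hbI h
      simp at this
  have hDm : ∀ᵐ t : ℝ, t ∈ Ioo (0 : ℝ) 1 → D t = deriv m t := by
    refine ae_eq_of_forall_test hDi hm1.continuous.integrableOn_Ioo_zero_one
      fun b hb hbc hbI => ?_
    have := hG b hb hbc
    rw [(hends hbI).1, (hends hbI).2] at this
    linarith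
  have hDm' : ∀ q : ℝ → ℝ, ∫ t in Ioo (0 : ℝ) 1, D t * q t =
      ∫ t in Ioo (0 : ℝ) 1, deriv m t * q t := fun q => by
    refine integral_congr_ae ((ae_restrict_iff' measurableSet_Ioo).2 ?_)
    filter_upwards [hDm] with t ht htI
    rw [ht htI]
  have hm1z : m 1 = 0 := by
    -- A bump with value `1` at `1` and `0` at `0` isolates the boundary term at `x₂ = 1`.
    let κ : ContDiffBump (1 : ℝ) := ⟨1 / 4, 1 / 2, by norm_num, by norm_num⟩
    have h := hG κ κ.contDiff κ.hasCompactSupport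
    have e1 : κ 1 = 1 := κ.one_of_mem_closedBall (Metric.mem_closedBall_self κ.rIn_pos.le)
    have e0 : κ 0 = 0 := κ.zero_of_le_dist (by simp [κ]; norm_num)
    rw [hDm', e0, e1] at h
    linarith
  -- Moving both `x₁` derivatives onto `a` turns the Poisson equation into an ODE for `m`. It holds
  -- almost everywhere first, then on the closed interval by continuity of `m''`.
  have hode : EqOn (deriv (deriv m)) (fun t => k * m t - C * I) (Icc 0 1) := by
    have hmc := hm.continuous
    refine eqOn_Icc_of_ae_eq hm2 (by fun_prop) ?_
    refine ae_eq_of_forall_test hm2.integrableOn_Ioo_zero_one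
      (by fun_prop : Continuous fun t => k * m t - C * I).integrableOn_Ioo_zero_one
      fun b hb hbc hbI => ?_
    have h1 := w.integral_poisson hw.1 hL ha hp hb hbc hbI
    have h2 := w.integral_mul_deriv_fst hL ha' hp' hb hbc hbI
    have e2 : ∫ x in Omega0 L, w.toFun x * (deriv (deriv a) x.1 * b x.2) =
        -k * ∫ x in Omega0 L, w.toFun x * (a x.1 * b x.2) := by
      rw [← integral_const_mul]
      congr 1; ext x
      rw [hak]; ring
    rw [e2, pair_w b hb.continuous] at h2
    have e3 : ∫ x in Omega0 L, a x.1 * b x.2 = I * ∫ t in Ioo (0 : ℝ) 1, b t := by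
      rw [hI, Omega0, Measure.volume_eq_prod, ← Measure.prod_restrict, integral_prod_mul]
    rw [pair_d _ (hb.continuous_deriv (by simp)), hDm', integral_Ioo_by_parts hm1 hb, e3,
      (hends hbI).1, (hends hbI).2] at h1
    have i1 : IntegrableOn (fun t => k * (m t * b t)) (Ioo 0 1) :=
      ((hmc.mul hb.continuous).const_mul k).integrableOn_Ioo_zero_one
    have i2 : IntegrableOn (fun t => C * I * b t) (Ioo 0 1) :=
      (hb.continuous.const_mul (C * I)).integrableOn_Ioo_zero_one
    have e4 : ∫ t in Ioo (0 : ℝ) 1, (k * m t - C * I) * b t =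
        k * (∫ t in Ioo (0 : ℝ) 1, m t * b t) - C * I * ∫ t in Ioo (0 : ℝ) 1, b t := by
      rw [← integral_const_mul, ← integral_const_mul, ← integral_sub i1 i2]
      congr 1; ext t; ring
    rw [e4]
    linarith
  have hUd : ∀ t, HasDerivAt U (deriv U t) t := fun t =>
    (hU.differentiable (by simp) t).hasDerivAt
  have hUd' : ∀ t, HasDerivAt (deriv U) (deriv (deriv U) t) t := fun t =>
    (hU'.differentiable (by simp) t).hasDerivAt
  have hn1 : deriv (fun t => m t - U t * I) = fun t => deriv m t - deriv U t * I :=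
    funext fun t => (((hmC.differentiable (by norm_num) t).hasDerivAt).sub
      ((hUd t).mul_const I)).deriv
  have hn2 : ∀ t, deriv (deriv fun t => m t - U t * I) t = deriv (deriv m) t + C * I := fun t => by
    rw [hn1]
    have := (((hm1.differentiable (by norm_num) t).hasDerivAt).sub ((hUd' t).mul_const I)).deriv
    rw [hU2] at this
    exact this.trans (by ring)
  have hzero := eq_zero_of_mode (n := fun t => m t - U t * I) hk hε hb hc
    (hm.sub ((contDiff_infty.1 hU 2).mul contDiff_const))
    (fun t ht => by
      rw [hn2, hode ht]
      linear_combination U t * hkI)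
    (by simp [hm1z, hU1])
    (by
      rw [hn2, hn1]
      linear_combination hm0 - I * hU0)
  filter_upwards [hma', ae_restrict_mem measurableSet_Ioo] with t ht htI
  rw [ht]
  linarith [hzero t (Ioo_subset_Icc_self htI)]

/-! ### Completeness of the trigonometric system and conclusion -/

/-- The real sine and cosine pairings are the real and imaginary parts of the Fourier coefficients,
up to normalization and the sign of `n`; Parseval's identity gives the rest. -/
theorem integral_sq_eq_zero_of_modes {L : ℝ} (hL : 0 < L) {g : ℝ → ℝ}
    (hg : MemLp g 2 (volume.restrict (Ioo 0 L)))
    (hcos : ∀ n : ℤ, ∫ s in Ioo 0 L, g s * Real.cos (2 * Real.pi * n / L * s) = 0)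
    (hsin : ∀ n : ℤ, ∫ s in Ioo 0 L, g s * Real.sin (2 * Real.pi * n / L * s) = 0) :
    ∫ s in Ioo 0 L, g s ^ 2 = 0 := by
  have hfin : IsFiniteMeasure (volume.restrict (Ioo 0 L)) :=
    isFiniteMeasure_restrict.2 measure_Ioo_lt_top.ne
  have hgi : IntegrableOn g (Ioo 0 L) := hg.integrable (by norm_num)
  have hg2 : MemLp (fun s => (g s : ℂ)) 2 (volume.restrict (Ioc 0 L)) := by
    rw [← restrict_Ioo_eq_restrict_Ioc]
    exact hg.ofReal
  have hcoef : ∀ n : ℤ, fourierCoeffOn hL (fun s => (g s : ℂ)) n = 0 := by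
    intro n
    rw [fourierCoeffOn_eq_integral, intervalIntegral.integral_of_le hL.le,
      integral_Ioc_eq_integral_Ioo]
    have e : ∀ s : ℝ, fourier (-n) (s : AddCircle (L - 0)) • (g s : ℂ) =
        ((g s * Real.cos (2 * Real.pi * (-n : ℤ) / L * s) : ℝ) : ℂ) +
          ((g s * Real.sin (2 * Real.pi * (-n : ℤ) / L * s) : ℝ) : ℂ) * Complex.I := by
      intro s
      rw [fourier_coe_apply, smul_eq_mul, show 2 * (Real.pi : ℂ) * Complex.I * ((-n : ℤ) : ℂ) * s /
        ((L - 0 : ℝ) : ℂ) = ((2 * Real.pi * (-n : ℤ) / L * s : ℝ) : ℂ) * Complex.I by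
          push_cast; ring, Complex.exp_mul_I]
      push_cast
      ring
    have i1 : IntegrableOn (fun s => g s * Real.cos (2 * Real.pi * (-n : ℤ) / L * s)) (Ioo 0 L) :=
      Integrable.mul_bdd (c := 1) hgi (by fun_prop)
        (Filter.Eventually.of_forall fun s => Real.abs_cos_le_one _)
    have i2 : IntegrableOn (fun s => g s * Real.sin (2 * Real.pi * (-n : ℤ) / L * s)) (Ioo 0 L) :=
      Integrable.mul_bdd (c := 1) hgi (by fun_prop)
        (Filter.Eventually.of_forall fun s => Real.abs_sin_le_one _)
    simp only [e]
    rw [integral_add i1.ofReal (i2.ofReal.mul_const _), integral_mul_const,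
      integral_complex_ofReal, integral_complex_ofReal, hcos, hsin]
    simp
  have h := tsum_sq_fourierCoeffOn hL hg2
  simp only [hcoef, norm_zero, ne_eq, OfNat.ofNat_ne_zero, not_false_eq_true, zero_pow, tsum_zero,
    sub_zero, smul_eq_mul, Complex.norm_real, Real.norm_eq_abs, sq_abs] at h
  rw [intervalIntegral.integral_of_le hL.le, integral_Ioc_eq_integral_Ioo] at h
  rcases mul_eq_zero.1 h.symm with h | h
  · exact absurd h (inv_ne_zero hL.ne')
  · exact h

theorem deriv_deriv_cos_mul (κ s : ℝ) :
    deriv (deriv fun s => Real.cos (κ * s)) s = -κ ^ 2 * Real.cos (κ * s) := by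
  have h1 : ∀ s, HasDerivAt (fun s => Real.cos (κ * s)) (-Real.sin (κ * s) * κ) s := fun s => by
    simpa using ((hasDerivAt_id s).const_mul κ).cos
  have h2 : HasDerivAt (fun s => -Real.sin (κ * s) * κ) (-(Real.cos (κ * s) * κ) * κ) s := by
    simpa using (((hasDerivAt_id s).const_mul κ).sin.neg).mul_const κ
  rw [funext fun s => (h1 s).deriv, h2.deriv]
  ring

theorem deriv_deriv_sin_mul (κ s : ℝ) :
    deriv (deriv fun s => Real.sin (κ * s)) s = -κ ^ 2 * Real.sin (κ * s) := by
  have h1 : ∀ s, HasDerivAt (fun s => Real.sin (κ * s)) (Real.cos (κ * s) * κ) s := fun s => by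
    simpa using ((hasDerivAt_id s).const_mul κ).sin
  have h2 : HasDerivAt (fun s => Real.cos (κ * s) * κ) (-Real.sin (κ * s) * κ * κ) s := by
    simpa using (((hasDerivAt_id s).const_mul κ).cos).mul_const κ
  rw [funext fun s => (h1 s).deriv, h2.deriv]
  ring

theorem IsSolution.same_ofProfile {L C ε b c : ℝ} (hL : 0 < L) (hε : 0 < ε) (hb : 0 < b)
    (hc : c ≤ 0) {U : ℝ → ℝ} (hU : ContDiff ℝ ∞ U) (hU1 : U 1 = 0)
    (hU2 : ∀ s, deriv (deriv U) s = -C)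
    (hU0 : U 0 = ε * b * deriv U 0 + ε ^ 2 / 2 * c * (-C)) {w : H11 L}
    (hw : IsSolution C ε b c w) : w.Same (H11.ofProfile L hU hU1) := by
  have shift : ∀ (n : ℤ) (s : ℝ), 2 * Real.pi * n / L * (s + L) =
      2 * Real.pi * n / L * s + n * (2 * Real.pi) := fun n s => by field_simp
  have zero_of_mode : ∀ {a : ℝ → ℝ} (κ : ℝ), ContDiff ℝ ∞ a → Function.Periodic a L →
      (∀ s, deriv (deriv a) s = -κ ^ 2 * a s) → ∀ᵐ t ∂(volume.restrict (Ioo (0 : ℝ) 1)),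
      ∫ s in Ioo 0 L, (w.toFun (s, t) - U t) * a s = 0 := by
    intro a κ ha hp hak
    have hai : IntegrableOn a (Ioo 0 L) :=
      (ha.continuous.integrableOn_Icc (a := 0) (b := L)).mono_set Ioo_subset_Icc_self
    filter_upwards [hw.pairing_eq hL hε hb hc hU hU1 hU2 hU0 ha hp (sq_nonneg κ) hak,
      ae_integrableOn_section (integrableOn_mul_prod w.integrableOn_toFun ha.continuous
        (q := fun _ => 1) continuous_const)] with t ht hi
    simp only [mul_one] at hi
    simp only [sub_mul]
    rw [integral_sub hi (hai.const_mul _), integral_const_mul, ht, sub_self]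
  have hsq : IntegrableOn (fun x => (w.toFun x - U x.2) ^ 2) (Omega0 L) :=
    (w.memLp.sub (memLp_comp_snd hU.continuous L)).integrable_sq
  have hΩ := (isOpen_Omega0 L).measurableSet
  have hzero : ∫ x in Omega0 L, (w.toFun x - U x.2) ^ 2 = 0 := by
    rw [integral_Omega0 hsq]
    refine integral_eq_zero_of_ae ?_
    -- The exceptional set of heights depends on the mode; as the modes are countable, almost every
    -- height works for all of them at once.
    have hcos := ae_all_iff.2 fun n : ℤ => zero_of_mode (2 * Real.pi * n / L)
      (a := fun s => Real.cos (2 * Real.pi * n / L * s)) (by fun_prop)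
      (fun s => by simp only [shift, Real.cos_add_int_mul_two_pi]) (deriv_deriv_cos_mul _)
    have hsin := ae_all_iff.2 fun n : ℤ => zero_of_mode (2 * Real.pi * n / L)
      (a := fun s => Real.sin (2 * Real.pi * n / L * s)) (by fun_prop)
      (fun s => by simp only [shift, Real.sin_add_int_mul_two_pi]) (deriv_deriv_sin_mul _)
    filter_upwards [hcos, hsin, ae_integrableOn_section hsq,
      ae_integrableOn_section w.integrableOn_toFun] with t h1 h2 h3 h4
    have hm : AEStronglyMeasurable (fun s => w.toFun (s, t) - U t) (volume.restrict (Ioo 0 L)) :=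
      h4.1.sub aestronglyMeasurable_const
    exact integral_sq_eq_zero_of_modes hL ((memLp_two_iff_integrable_sq hm).2 h3) h1 h2
  have := (integral_eq_zero_iff_of_nonneg (fun _ => sq_nonneg _) hsq).1 hzero
  filter_upwards [this] with x hx
  have h0 : w.toFun x - U x.2 = 0 := by simpa using hx
  simp only [H11.ofProfile]
  linarith

end WallLaw

theorem mainTheorem9
    (f : ℝ → ℝ) (K : NNReal) (δ : ℝ)
    (hf_lip : LipschitzWith K f) (hf_per : Function.Periodic f (2 * Real.pi))
    (hδ : 0 < δ) (hf_lower : ∀ t, -1 ≤ f t) (hf_upper : ∀ t, f t < -δ)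
    (β γ : WallLaw.D12 f)
    (hβ : WallLaw.IsCellSolution f (fun t => -f t) β)
    (hγ : WallLaw.IsCellSolution f (fun t => -(f t) ^ 2) γ)
    (βbar γbar : ℝ)
    (hβbar : WallLaw.HasInterfaceMean β βbar)
    (hγbar : WallLaw.HasInterfaceMean γ γbar)
    (ε L C : ℝ) (N : ℕ) (hε : 0 < ε) (hN : 0 < N) (hL : L = N * (2 * Real.pi * ε)) :
    ∃ u : WallLaw.H11 L,
      (WallLaw.IsSolution C ε βbar γbar u ∧
        ∀ w : WallLaw.H11 L, WallLaw.IsSolution C ε βbar γbar w → w.Same u) ∧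
      (WallLaw.IsVariationalSolution C ε βbar γbar u ∧
        ∀ w : WallLaw.H11 L, WallLaw.IsVariationalSolution C ε βbar γbar w → w.Same u) := by
  have hLpos : 0 < L := by
    rw [hL]
    have : (0 : ℝ) < N := by exact_mod_cast hN
    have := Real.pi_pos
    positivity
  have hcont := hf_lip.continuous
  have hneg : ∀ t, f t < 0 := fun t => by linarith [hf_upper t]
  have hb : 0 < βbar := by
    -- The maximum principle gives upper bounds, so the lower bound `βbar ≥ δ` is obtained from
    -- `-β`, whose data are `f`.
    have := hβ.neg.interfaceMean_le hcont hf_lower hneg (c := -δ)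
      (fun t => by linarith [hf_upper t]) hβbar.neg
    linarith
  have hc : γbar ≤ 0 :=
    hγ.interfaceMean_le hcont hf_lower hneg (fun t => by linarith [sq_nonneg (f t)]) hγbar
  obtain ⟨U, hU, hU1, hU2, hU0⟩ := WallLaw.exists_profile C γbar hε hb
  have hvar := WallLaw.isVariationalSolution_ofProfile hLpos hε hb hU hU1 hU2 hU0
  exact ⟨WallLaw.H11.ofProfile L hU hU1,
    ⟨⟨WallLaw.solvesPoisson_ofProfile hU hU1 hU2, WallLaw.solvesWentzell_ofProfile hU hU1 hU2 hU0⟩,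
      fun w hw => hw.same_ofProfile hLpos hε hb hc hU hU1 hU2 hU0⟩,
    hvar, fun w hw => hvar.same hLpos hε hb hc hw⟩
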